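/- Let $(N^3,h)$ be a smooth Riemannian $3$-manifold with nonpositive sectional curvature, let $(M^2,g)$ be a smooth Riemannian surface, and let $\varphi:(M^2,g)\to(N^3,h)$ be an isometric immersion ($g=\varphi^*h$) that is totally umbilical, i.e. its second fundamental form $B=\nabla d\varphi$ satisfies $B(X,Y)=g(X,Y)\,\eta$ with $\eta=\tfrac12\operatorname{Trace}_g B$ the mean curvature vector field. Let $\lambda:M\to(0,\infty)$ be a function such that $\bar g=\lambda^{-2}g$ is a smooth Riemannian metric on $M$, and suppose that the conformal immersion $\varphi:(M^2,\bar g)\to(N^3,h)$ is biharmonic, i.e. its bitension field $$\tau_2(\varphi)=\operatorname{Trace}_{\bar g}\bigl(\nabla^{\varphi}\nabla^{\varphi}-\nabla^{\varphi}_{\nabla^{M}}\bigr)\tau(\varphi)-\operatorname{Trace}_{\bar g}R^{N}(d\varphi,\tau(\varphi))d\varphi$$ vanishes identically, where $\tau(\varphi)=\operatorname{Trace}_{\bar g}\nabla d\varphi$ is the tension field, $\nabla^M$ and $\nabla d\varphi$ are here taken with respect to $\bar g$ (and $h$), and $R^N(X,Y)Z=[\nabla^N_X,\nabla^N_Y]Z-\nabla^N_{[X,Y]}Z$.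 Then $\varphi:(M^2,\bar g)\to(N^3,h)$ is harmonic, i.e. $\tau(\varphi)\equiv 0$. Moreover, the surface $\varphi:(M^2,g)\to(N^3,h)$ is totally geodesic, i.e. $B\equiv 0$. -/

import Mathlib

open scoped Manifold ContDiff

noncomputable section

/-- The coordinate space `ℝⁿ` on which the manifolds of dimension `n` are modelled. -/
abbrev Coord (n : ℕ) : Type := EuclideanSpace ℝ (Fin n)

/-- A smooth (`C^∞`) Riemannian metric on a smooth manifold of dimension `n`. -/
abbrev SmoothMetric (n : ℕ) (M : Type*) [TopologicalSpace M] [ChartedSpace (Coord n) M]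
    [IsManifold (𝓡 n) ∞ M] : Type _ :=
  Bundle.ContMDiffRiemannianMetric (𝓡 n) ∞ (Coord n) (fun x : M => TangentSpace (𝓡 n) x)

/-- A chart of the maximal smooth atlas of `M` (a local coordinate system). -/
def IsSmoothChart (n : ℕ) {M : Type*} [TopologicalSpace M] [ChartedSpace (Coord n) M]
    (e : OpenPartialHomeomorph M (Coord n)) : Prop :=
  e ∈ IsManifold.maximalAtlas (𝓡 n) ∞ M

/-! ### Riemannian geometry in local coordinates -/

namespace LocalGeom

variable {m n : ℕ}

/-- The partial derivative `∂ᵢ f` of a real function of `m` variables. -/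
def pd (i : Fin m) (f : Coord m → ℝ) (p : Coord m) : ℝ :=
  fderiv ℝ f p (EuclideanSpace.single i 1)

/-- The Christoffel symbol `Γᵏᵢⱼ = ½ ∑ₗ gᵏˡ (∂ᵢ gⱼₗ + ∂ⱼ gᵢₗ - ∂ₗ gᵢⱼ)` of the Levi-Civita
connection of the metric with coefficient matrix `G`. -/
def christoffel (G : Coord m → Matrix (Fin m) (Fin m) ℝ) (k i j : Fin m) (p : Coord m) : ℝ :=
  (1 / 2) * ∑ l, (G p)⁻¹ k l *
    (pd i (fun q => G q j l) p + pd j (fun q => G q i l) p - pd l (fun q => G q i j) p)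

/-- The component `Rˡₖᵢⱼ` of the curvature tensor: `R(∂ᵢ, ∂ⱼ) ∂ₖ = ∑ₗ Rˡₖᵢⱼ ∂ₗ`, where
`R(X, Y) Z = ∇_X ∇_Y Z - ∇_Y ∇_X Z - ∇_{[X, Y]} Z`. -/
def curvatureComponent (G : Coord m → Matrix (Fin m) (Fin m) ℝ) (l k i j : Fin m)
    (p : Coord m) : ℝ :=
  pd i (christoffel G l j k) p - pd j (christoffel G l i k) p +
    ∑ a, (christoffel G l i a p * christoffel G a j k p -
      christoffel G l j a p * christoffel G a i k p)

/-- The curvature operator: the coordinate vector of `R(X, Y) Z` at `p`. -/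
def curvatureOperator (G : Coord m → Matrix (Fin m) (Fin m) ℝ) (p : Coord m)
    (X Y Z : Fin m → ℝ) (l : Fin m) : ℝ :=
  ∑ k, ∑ i, ∑ j, curvatureComponent G l k i j p * X i * Y j * Z k

/-- The inner product `⟨X, Y⟩` at `p` of two vectors given in coordinates. -/
def metricInner (G : Coord m → Matrix (Fin m) (Fin m) ℝ) (p : Coord m) (X Y : Fin m → ℝ) : ℝ :=
  ∑ i, ∑ j, G p i j * X i * Y j

/-- The sectional curvature `⟨R(X, Y) Y, X⟩ / (|X|² |Y|² - ⟨X, Y⟩²)` of the plane spanned by `X`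
and `Y` at `p`; it is only used for linearly independent `X` and `Y`. -/
def sectionalCurvature (G : Coord m → Matrix (Fin m) (Fin m) ℝ) (p : Coord m)
    (X Y : Fin m → ℝ) : ℝ :=
  metricInner G p (curvatureOperator G p X Y Y) X /
    (metricInner G p X X * metricInner G p Y Y - metricInner G p X Y ^ 2)

/-- The vector `du(∂ᵢ)`, with components `∂ᵢ u^α`. -/
def push (u : Coord m → Coord n) (i : Fin m) (p : Coord m) (α : Fin n) : ℝ :=
  pd i (fun q => u q α) p

/-- The connection `∇^u` induced on vector fields along the map `u` by the Levi-Civita connection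
of the target metric `H`: `(∇^u_{∂ᵢ} V)^α = ∂ᵢ V^α + ∑ Γ^α_{βγ}(u) ∂ᵢ u^β V^γ`. -/
def covAlong (H : Coord n → Matrix (Fin n) (Fin n) ℝ) (u : Coord m → Coord n) (i : Fin m)
    (V : Coord m → Fin n → ℝ) (p : Coord m) (α : Fin n) : ℝ :=
  pd i (fun q => V q α) p +
    ∑ β, ∑ γ, christoffel H α β γ (u p) * push u i p β * V p γ

/-- The second fundamental form of the map `u`, i.e. the Hessian
`∇du(∂ᵢ, ∂ⱼ) = ∇^u_{∂ᵢ}(du(∂ⱼ)) - du(∇_{∂ᵢ} ∂ⱼ)`. For an isometric immersion this is the second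
fundamental form of the immersed submanifold. -/
def secondForm (G : Coord m → Matrix (Fin m) (Fin m) ℝ) (H : Coord n → Matrix (Fin n) (Fin n) ℝ)
    (u : Coord m → Coord n) (i j : Fin m) (p : Coord m) (α : Fin n) : ℝ :=
  covAlong H u i (push u j) p α - ∑ k, christoffel G k i j p * push u k p α

/-- The tension field `τ(u) = Trace_g ∇du`. -/
def tension (G : Coord m → Matrix (Fin m) (Fin m) ℝ) (H : Coord n → Matrix (Fin n) (Fin n) ℝ)
    (u : Coord m → Coord n) (p : Coord m) (α : Fin n) : ℝ :=
  ∑ i, ∑ j, (G p)⁻¹ i j * secondForm G H u i j p α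

/-- The rough Laplacian `Trace_g (∇^u ∇^u - ∇^u_{∇^M}) V` of a vector field `V` along `u`. -/
def roughLaplacian (G : Coord m → Matrix (Fin m) (Fin m) ℝ)
    (H : Coord n → Matrix (Fin n) (Fin n) ℝ) (u : Coord m → Coord n)
    (V : Coord m → Fin n → ℝ) (p : Coord m) (α : Fin n) : ℝ :=
  ∑ i, ∑ j, (G p)⁻¹ i j * (covAlong H u i (covAlong H u j V) p α -
    ∑ k, christoffel G k i j p * covAlong H u k V p α)

/-- The bitension field
`τ₂(u) = Trace_g (∇^u ∇^u - ∇^u_{∇^M}) τ(u) - Trace_g Rᴺ(du, τ(u)) du`. -/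
def bitension (G : Coord m → Matrix (Fin m) (Fin m) ℝ) (H : Coord n → Matrix (Fin n) (Fin n) ℝ)
    (u : Coord m → Coord n) (p : Coord m) (α : Fin n) : ℝ :=
  roughLaplacian G H u (tension G H u) p α -
    ∑ i, ∑ j, (G p)⁻¹ i j *
      curvatureOperator H (u p) (push u i p) (tension G H u p) (push u j p) α

end LocalGeom

/-! ### Passage to manifolds -/

section Manifold

variable {m n : ℕ}
  {M : Type*} [TopologicalSpace M] [ChartedSpace (Coord m) M] [IsManifold (𝓡 m) ∞ M]
  {N : Type*} [TopologicalSpace N] [ChartedSpace (Coord n) N] [IsManifold (𝓡 n) ∞ N]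

/-- The coordinate vector field `∂ᵢ` of the chart `e`, at the point with coordinates `p`. -/
def coordVector (e : OpenPartialHomeomorph M (Coord m)) (i : Fin m) (p : Coord m) :
    TangentSpace (𝓡 m) (e.symm p) :=
  mfderiv (𝓡 m) (𝓡 m) e.symm p (EuclideanSpace.single i (1 : ℝ) : Coord m)

/-- The coefficient matrix `gᵢⱼ = g(∂ᵢ, ∂ⱼ)` of the metric `g` in the chart `e`, as a function of
the coordinates (meaningful on `e.target`). -/
def metricInChart (g : SmoothMetric m M) (e : OpenPartialHomeomorph M (Coord m)) (p : Coord m) :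
    Matrix (Fin m) (Fin m) ℝ :=
  Matrix.of fun i j => g.inner (e.symm p) (coordVector e i p) (coordVector e j p)

/-- The coordinate expression `e' ∘ φ ∘ e⁻¹` of a map `φ` between manifolds. -/
def mapInCharts (φ : M → N) (e : OpenPartialHomeomorph M (Coord m))
    (e' : OpenPartialHomeomorph N (Coord n)) : Coord m → Coord n :=
  fun p => e' (φ (e.symm p))

/-- `(N, h)` is nonpositively curved: the sectional curvature of every tangent plane is `≤ 0`. -/
def NonpositivelyCurved (h : SmoothMetric n N) : Prop :=
  ∀ e : OpenPartialHomeomorph N (Coord n), IsSmoothChart n e → ∀ p ∈ e.target,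
    ∀ X Y : Fin n → ℝ, LinearIndependent ℝ ![X, Y] →
      LocalGeom.sectionalCurvature (metricInChart h e) p X Y ≤ 0

/-- `φ : (M, g) → (N, h)` is a (smooth) isometric immersion: `g = φ^* h`. The differential is
then automatically injective, as `g` is positive definite. -/
def IsIsometricImmersion (g : SmoothMetric m M) (h : SmoothMetric n N) (φ : M → N) : Prop :=
  ContMDiff (𝓡 m) (𝓡 n) ∞ φ ∧
    ∀ (x : M) (v w : TangentSpace (𝓡 m) x),
      h.inner (φ x) (mfderiv (𝓡 m) (𝓡 n) φ x v) (mfderiv (𝓡 m) (𝓡 n) φ x w) = g.inner x v w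

/-- A condition `P e e' p` on the coordinate expression of `φ` holds at all points of `M`, in all
smooth charts `e` of `M` and `e'` of `N` around the point and its image. -/
def InAllCharts (φ : M → N)
    (P : OpenPartialHomeomorph M (Coord m) → OpenPartialHomeomorph N (Coord n) →
      Coord m → Prop) : Prop :=
  ∀ (e : OpenPartialHomeomorph M (Coord m)) (e' : OpenPartialHomeomorph N (Coord n)),
    IsSmoothChart m e → IsSmoothChart n e' →
      ∀ p ∈ e.target, φ (e.symm p) ∈ e'.source → P e e' p

/-- `φ : (M, g) → (N, h)` is harmonic: `τ(φ) = 0`. -/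
def IsHarmonicMap (g : SmoothMetric m M) (h : SmoothMetric n N) (φ : M → N) : Prop :=
  InAllCharts φ fun e e' p => ∀ α,
    LocalGeom.tension (metricInChart g e) (metricInChart h e') (mapInCharts φ e e') p α = 0

/-- `φ : (M, g) → (N, h)` is biharmonic: `τ₂(φ) = 0`. -/
def IsBiharmonicMap (g : SmoothMetric m M) (h : SmoothMetric n N) (φ : M → N) : Prop :=
  InAllCharts φ fun e e' p => ∀ α,
    LocalGeom.bitension (metricInChart g e) (metricInChart h e') (mapInCharts φ e e') p α = 0

/-- An isometric immersion `φ : (M, g) → (N, h)` is totally umbilical: its second fundamental form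
is `B(X, Y) = g(X, Y) η`, with `η = (1/m) Trace_g B` the mean curvature vector field. -/
def IsTotallyUmbilical (g : SmoothMetric m M) (h : SmoothMetric n N) (φ : M → N) : Prop :=
  InAllCharts φ fun e e' p => ∀ i j α,
    LocalGeom.secondForm (metricInChart g e) (metricInChart h e') (mapInCharts φ e e') i j p α =
      metricInChart g e p i j * ((1 / (m : ℝ)) *
        LocalGeom.tension (metricInChart g e) (metricInChart h e') (mapInCharts φ e e') p α)

/-- An isometric immersion `φ : (M, g) → (N, h)` is totally geodesic: its second fundamental form
vanishes. -/
def IsTotallyGeodesic (g : SmoothMetric m M) (h : SmoothMetric n N) (φ : M → N) : Prop :=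
  InAllCharts φ fun e e' p => ∀ i j α,
    LocalGeom.secondForm (metricInChart g e) (metricInChart h e') (mapInCharts φ e e') i j p α = 0

/-- `gbar = λ⁻² g` with `λ : M → (0, ∞)`. If `φ : (M, g) → (N, h)` is an isometric immersion,
then `φ : (M, gbar) → (N, h)` is a conformal immersion with conformal factor `λ`. -/
def IsConformalRescaling (g gbar : SmoothMetric m M) (lam : M → ℝ) : Prop :=
  (∀ x, 0 < lam x) ∧
    ∀ (x : M) (v w : TangentSpace (𝓡 m) x), gbar.inner x v w = (lam x ^ 2)⁻¹ * g.inner x v w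

end Manifold

end

/-! Let `w` be the tension field for the rescaled metric. In dimension two the trace of a Hessian
only picks up the conformal factor (`conformal_trace_christoffel`), so `w = λ² τ_g = 2λ² η`. For the
same reason that factor cancels from the bitension equation, which becomes the Jacobi equation `Δw =
Trace_g R(dφ, w)dφ` for the original metric `g`.

Tangential part: put `s = ⟨w, η⟩`. By Weingarten the tangential part of `∇ᵢw` is `-s dφ(∂ᵢ)`. One
more derivative gives `⟨Δw, dφ(∂ₖ)⟩ = -∂ₖs - ⟨∇ₖw, η⟩`. Codazzi, read off from the commutator of
Hessians, turns the curvature trace into `(1 - m)(∂ₖs - ⟨∇ₖw, η⟩)` on an `m`-dimensional source. For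
`m = 2` the terms `∂ₖs` cancel and leave `⟨∇ₖw, η⟩ = 0` (`IsUmbilicOn.inner_covAlong_eq_zero`). As
`w` is a multiple of `η`, its length is locally constant.

Pairing with `w`: the Jacobi equation now reads `-|∇w|² = Trace_g ⟨R(dφ, w)dφ, w⟩`, and nonpositive
curvature makes the right side nonnegative. But the tangential part of `∇w` alone forces `|∇w|² ≥
2s²`, hence `s = 0`. Since `s = 2λ²|η|²`, this gives `η = 0` (`IsUmbilicOn.normal_eq_zero`). The
argument is local, so it runs in a pair of charts. -/

namespace LocalGeom

variable {m n : ℕ}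

/-! ### Partial derivatives -/

section PartialDerivatives

variable {f g : Coord m → ℝ} {U : Set (Coord m)} {p : Coord m}

lemma differentiableAt_of_contDiffOn (hU : IsOpen U) (hf : ContDiffOn ℝ ∞ f U) (hp : p ∈ U) :
    DifferentiableAt ℝ f p :=
  (hf.contDiffAt (hU.mem_nhds hp)).differentiableAt (by simp)

lemma contDiffOn_pd (hU : IsOpen U) (hf : ContDiffOn ℝ ∞ f U) (i : Fin m) :
    ContDiffOn ℝ ∞ (pd i f) U :=
  (hf.fderiv_of_isOpen hU (by simp)).clm_apply contDiffOn_const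

lemma pd_congr (hU : IsOpen U) (hp : p ∈ U) (h : ∀ q ∈ U, f q = g q) (i : Fin m) :
    pd i f p = pd i g p := by
  have : f =ᶠ[nhds p] g := Filter.eventually_of_mem (hU.mem_nhds hp) h
  simp only [pd, this.fderiv_eq]

lemma pd_const (i : Fin m) (c : ℝ) : pd i (fun _ => c) p = 0 := by
  simp [pd]

lemma pd_add (i : Fin m) (hf : DifferentiableAt ℝ f p) (hg : DifferentiableAt ℝ g p) :
    pd i (fun q => f q + g q) p = pd i f p + pd i g p := by
  simp [pd, fderiv_fun_add hf hg]

lemma pd_mul (i : Fin m) (hf : DifferentiableAt ℝ f p) (hg : DifferentiableAt ℝ g p) :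
    pd i (fun q => f q * g q) p = pd i f p * g p + f p * pd i g p := by
  simp [pd, fderiv_fun_mul hf hg]; ring

lemma pd_sum {ι : Type*} (s : Finset ι) {F : ι → Coord m → ℝ} (i : Fin m)
    (hF : ∀ a ∈ s, DifferentiableAt ℝ (F a) p) :
    pd i (fun q => ∑ a ∈ s, F a q) p = ∑ a ∈ s, pd i (F a) p := by
  simp [pd, fderiv_fun_sum hF]

lemma pd_comm (hU : IsOpen U) (hf : ContDiffOn ℝ ∞ f U) (hp : p ∈ U) (i j : Fin m) :
    pd i (pd j f) p = pd j (pd i f) p := by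
  have hfp := hf.contDiffAt (hU.mem_nhds hp)
  have hd : DifferentiableAt ℝ (fderiv ℝ f) p :=
    (hfp.fderiv_right (m := 1) (by norm_cast)).differentiableAt (by simp)
  have key : ∀ a b : Fin m, pd a (pd b f) p =
      fderiv ℝ (fderiv ℝ f) p (EuclideanSpace.single a 1) (EuclideanSpace.single b 1) := by
    intro a b
    change fderiv ℝ (fun q => fderiv ℝ f q (EuclideanSpace.single b 1)) p _ = _
    rw [fderiv_clm_apply hd (differentiableAt_const _)]
    simp
  rw [key, key]
  exact (hfp.isSymmSndFDerivAt (by simp; norm_cast)).eq _ _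

lemma fderiv_apply_eq_sum {F : Coord n → ℝ} (X q : Coord n) :
    fderiv ℝ F q X = ∑ c, pd c F q * X c := by
  have : X = ∑ c, X c • EuclideanSpace.single c (1 : ℝ) := by
    ext a; simp [Finset.sum_apply, Pi.single_apply]
  conv_lhs => rw [this]
  simp [pd, mul_comm]

lemma pd_comp {F : Coord n → ℝ} {u : Coord m → Coord n} (i : Fin m)
    (hF : DifferentiableAt ℝ F (u p)) (hu : ∀ α, DifferentiableAt ℝ (fun q => u q α) p) :
    pd i (fun q => F (u q)) p = ∑ c, pd c F (u p) * push u i p c := by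
  have hu' : DifferentiableAt ℝ u p := (differentiableAt_euclidean).2 hu
  have h1 : fderiv ℝ (fun q => F (u q)) p = (fderiv ℝ F (u p)).comp (fderiv ℝ u p) :=
    fderiv_comp p hF hu'
  rw [pd, h1, ContinuousLinearMap.comp_apply, fderiv_apply_eq_sum]
  refine Finset.sum_congr rfl fun c _ => ?_
  congr 1
  have h2 : HasFDerivAt (fun q => u q c) ((EuclideanSpace.proj c).comp (fderiv ℝ u p)) p :=
    (EuclideanSpace.proj c : Coord n →L[ℝ] ℝ).hasFDerivAt.comp p hu'.hasFDerivAt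
  simp [push, pd, h2.fderiv]

end PartialDerivatives

/-! ### Metrics in coordinates -/

/-- `G` is a smooth positive definite metric on the open set `U`. -/
structure IsMetricOn (G : Coord m → Matrix (Fin m) (Fin m) ℝ) (U : Set (Coord m)) : Prop where
  isOpen : IsOpen U
  smooth : ∀ i j, ContDiffOn ℝ ∞ (fun q => G q i j) U
  posDef : ∀ p ∈ U, (G p).PosDef

section Det

variable {U : Set (Coord m)}

lemma contDiffOn_det {A : Coord m → Matrix (Fin n) (Fin n) ℝ}
    (hA : ∀ i j, ContDiffOn ℝ ∞ (fun q => A q i j) U) :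
    ContDiffOn ℝ ∞ (fun q => (A q).det) U := by
  simp only [Matrix.det_apply]
  refine ContDiffOn.sum fun σ _ => ?_
  exact ContDiffOn.const_smul _ (contDiffOn_prod fun i _ => hA _ _)

/-- Cramer's rule: each adjugate entry is the determinant of `A` with one row replaced by a constant
vector. -/
lemma contDiffOn_inv_entry {A : Coord m → Matrix (Fin n) (Fin n) ℝ}
    (hA : ∀ i j, ContDiffOn ℝ ∞ (fun q => A q i j) U) (hdet : ∀ q ∈ U, (A q).det ≠ 0)
    (k l : Fin n) : ContDiffOn ℝ ∞ (fun q => (A q)⁻¹ k l) U := by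
  simp only [Matrix.inv_def, Ring.inverse_eq_inv', Matrix.smul_apply, smul_eq_mul,
    Matrix.adjugate_apply]
  refine ((contDiffOn_det hA).inv hdet).mul (contDiffOn_det fun i j => ?_)
  by_cases h : i = l
  · subst h; simp only [Matrix.updateRow_self]; exact contDiffOn_const
  · simp only [Matrix.updateRow_ne h]; exact hA i j

end Det

namespace IsMetricOn

variable {G : Coord m → Matrix (Fin m) (Fin m) ℝ} {U : Set (Coord m)} {p : Coord m}

lemma symm (hG : IsMetricOn G U) (hp : p ∈ U) (i j : Fin m) : G p i j = G p j i := by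
  have := (hG.posDef p hp).isHermitian.apply j i
  simpa using this

lemma det_ne_zero (hG : IsMetricOn G U) (hp : p ∈ U) : (G p).det ≠ 0 :=
  (hG.posDef p hp).det_pos.ne'

lemma diag_pos (hG : IsMetricOn G U) (hp : p ∈ U) (i : Fin m) : 0 < G p i i :=
  (hG.posDef p hp).diag_pos

lemma inv_mul (hG : IsMetricOn G U) (hp : p ∈ U) (i j : Fin m) :
    ∑ k, (G p)⁻¹ i k * G p k j = if i = j then 1 else 0 := by
  rw [← Matrix.mul_apply, Matrix.nonsing_inv_mul _ (isUnit_iff_ne_zero.2 (hG.det_ne_zero hp)),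
    Matrix.one_apply]

lemma mul_inv (hG : IsMetricOn G U) (hp : p ∈ U) (i j : Fin m) :
    ∑ k, G p i k * (G p)⁻¹ k j = if i = j then 1 else 0 := by
  rw [← Matrix.mul_apply, Matrix.mul_nonsing_inv _ (isUnit_iff_ne_zero.2 (hG.det_ne_zero hp)),
    Matrix.one_apply]

lemma inv_symm (hG : IsMetricOn G U) (hp : p ∈ U) (i j : Fin m) :
    (G p)⁻¹ i j = (G p)⁻¹ j i := by
  have := ((hG.posDef p hp).inv).isHermitian.apply j i
  simpa using this

lemma contDiffOn_inv (hG : IsMetricOn G U) (k l : Fin m) :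
    ContDiffOn ℝ ∞ (fun q => (G q)⁻¹ k l) U :=
  contDiffOn_inv_entry hG.smooth (fun _ hq => hG.det_ne_zero hq) k l

lemma contDiffOn_christoffel (hG : IsMetricOn G U) (k i j : Fin m) :
    ContDiffOn ℝ ∞ (christoffel G k i j) U := by
  unfold christoffel
  refine contDiffOn_const.mul (ContDiffOn.sum fun l _ => (hG.contDiffOn_inv k l).mul ?_)
  exact ((contDiffOn_pd hG.isOpen (hG.smooth _ _) _).add
    (contDiffOn_pd hG.isOpen (hG.smooth _ _) _)).sub (contDiffOn_pd hG.isOpen (hG.smooth _ _) _)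

lemma christoffel_symm (hG : IsMetricOn G U) (hp : p ∈ U) (k i j : Fin m) :
    christoffel G k i j p = christoffel G k j i p := by
  unfold christoffel
  congr 1
  refine Finset.sum_congr rfl fun l _ => ?_
  rw [pd_congr (f := fun q => G q i j) (g := fun q => G q j i) hG.isOpen hp
    (fun q hq => hG.symm hq i j)]
  ring

/-- The Christoffel symbols of the first kind. -/
lemma sum_mul_christoffel (hG : IsMetricOn G U) (hp : p ∈ U) (b i j : Fin m) :
    ∑ k, G p b k * christoffel G k i j p =
      (1 / 2) * (pd i (fun q => G q j b) p + pd j (fun q => G q i b) p -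
        pd b (fun q => G q i j) p) := by
  unfold christoffel
  calc _ = (1 / 2) * ∑ l, (∑ k, G p b k * (G p)⁻¹ k l) *
        (pd i (fun q => G q j l) p + pd j (fun q => G q i l) p - pd l (fun q => G q i j) p) := by
        simp only [Finset.mul_sum, Finset.sum_mul]
        rw [Finset.sum_comm]
        exact Finset.sum_congr rfl fun _ _ => Finset.sum_congr rfl fun _ _ => by ring
    _ = _ := by simp [hG.mul_inv hp]

end IsMetricOn

/-! ### Algebra of the inner product -/

section MetricInner

variable {G : Coord m → Matrix (Fin m) (Fin m) ℝ} {p : Coord m}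

lemma metricInner_add_left (X Y Z : Fin m → ℝ) :
    metricInner G p (fun α => X α + Y α) Z = metricInner G p X Z + metricInner G p Y Z := by
  simp only [metricInner, ← Finset.sum_add_distrib]
  exact Finset.sum_congr rfl fun _ _ => Finset.sum_congr rfl fun _ _ => by ring

lemma metricInner_sub_left (X Y Z : Fin m → ℝ) :
    metricInner G p (fun α => X α - Y α) Z = metricInner G p X Z - metricInner G p Y Z := by
  simp only [metricInner, ← Finset.sum_sub_distrib]
  exact Finset.sum_congr rfl fun _ _ => Finset.sum_congr rfl fun _ _ => by ring

lemma metricInner_smul_left (c : ℝ) (X Z : Fin m → ℝ) :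
    metricInner G p (fun α => c * X α) Z = c * metricInner G p X Z := by
  simp only [metricInner, Finset.mul_sum]
  exact Finset.sum_congr rfl fun _ _ => Finset.sum_congr rfl fun _ _ => by ring

lemma metricInner_sum_left {ι : Type*} (s : Finset ι) (X : ι → Fin m → ℝ) (Z : Fin m → ℝ) :
    metricInner G p (fun α => ∑ a ∈ s, X a α) Z = ∑ a ∈ s, metricInner G p (X a) Z := by
  classical
  induction s using Finset.induction_on with
  | empty => simp [metricInner]
  | insert a s ha ih => simp only [Finset.sum_insert ha, metricInner_add_left, ih]

lemma IsMetricOn.metricInner_comm {U : Set (Coord m)} (hG : IsMetricOn G U) (hp : p ∈ U)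
    (X Y : Fin m → ℝ) : metricInner G p X Y = metricInner G p Y X := by
  unfold metricInner
  rw [Finset.sum_comm]
  exact Finset.sum_congr rfl fun i _ => Finset.sum_congr rfl fun j _ => by
    rw [hG.symm hp i j]; ring

lemma IsMetricOn.metricInner_self_pos {U : Set (Coord m)} (hG : IsMetricOn G U) (hp : p ∈ U)
    {X : Fin m → ℝ} (hX : X ≠ 0) : 0 < metricInner G p X X := by
  have := (hG.posDef p hp).dotProduct_mulVec_pos hX
  have h : metricInner G p X X = star X ⬝ᵥ (G p).mulVec X := by
    simp only [metricInner, dotProduct, Matrix.mulVec, Finset.mul_sum, star_trivial]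
    exact Finset.sum_congr rfl fun i _ => Finset.sum_congr rfl fun j _ => by ring
  rwa [h]

lemma IsMetricOn.metricInner_self_nonneg {U : Set (Coord m)} (hG : IsMetricOn G U) (hp : p ∈ U)
    (X : Fin m → ℝ) : 0 ≤ metricInner G p X X := by
  by_cases hX : X = 0
  · simp [hX, metricInner]
  · exact (hG.metricInner_self_pos hp hX).le

end MetricInner

/-! ### The connection along a map -/

section CovAlong

/-- `u` is a smooth map on the open set `U`, with values in the domain `V` of the metric `H`. -/
structure IsMapOn (H : Coord n → Matrix (Fin n) (Fin n) ℝ) (V : Set (Coord n))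
    (u : Coord m → Coord n) (U : Set (Coord m)) : Prop where
  metric : IsMetricOn H V
  isOpen : IsOpen U
  smooth : ∀ α, ContDiffOn ℝ ∞ (fun q => u q α) U
  mapsTo : Set.MapsTo u U V

variable {H : Coord n → Matrix (Fin n) (Fin n) ℝ} {V : Set (Coord n)}
  {u : Coord m → Coord n} {U : Set (Coord m)} {p : Coord m}
  {X Y : Coord m → Fin n → ℝ}

/-- The field `X` along a map is smooth on `U`. -/
def IsFieldOn (X : Coord m → Fin n → ℝ) (U : Set (Coord m)) : Prop :=
  ∀ α, ContDiffOn ℝ ∞ (fun q => X q α) U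

lemma covAlong_congr (hU : IsOpen U) (hp : p ∈ U) (h : ∀ q ∈ U, ∀ α, X q α = Y q α) (i : Fin m)
    (α : Fin n) : covAlong H u i X p α = covAlong H u i Y p α := by
  unfold covAlong
  rw [pd_congr hU hp (fun q hq => h q hq α)]
  simp only [h p hp]

namespace IsMapOn

lemma differentiableAt_field (hu : IsMapOn H V u U) (hX : IsFieldOn X U) (hp : p ∈ U)
    (α : Fin n) : DifferentiableAt ℝ (fun q => X q α) p :=
  differentiableAt_of_contDiffOn hu.isOpen (hX α) hp

lemma differentiableAt (hu : IsMapOn H V u U) (hp : p ∈ U) (α : Fin n) :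
    DifferentiableAt ℝ (fun q => u q α) p :=
  differentiableAt_of_contDiffOn hu.isOpen (hu.smooth α) hp

lemma contDiffOn_comp (hu : IsMapOn H V u U) {F : Coord n → ℝ} (hF : ContDiffOn ℝ ∞ F V) :
    ContDiffOn ℝ ∞ (fun q => F (u q)) U :=
  hF.comp (contDiffOn_euclidean.2 hu.smooth) hu.mapsTo

lemma push_smooth (hu : IsMapOn H V u U) (i : Fin m) : IsFieldOn (push u i) U :=
  fun α => contDiffOn_pd hu.isOpen (hu.smooth α) i

lemma covAlong_smooth (hu : IsMapOn H V u U) (hX : IsFieldOn X U) (i : Fin m) :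
    IsFieldOn (covAlong H u i X) U := fun α =>
  (contDiffOn_pd hu.isOpen (hX α) i).add <| ContDiffOn.sum fun β _ => ContDiffOn.sum fun γ _ =>
    ((hu.contDiffOn_comp (hu.metric.contDiffOn_christoffel α β γ)).mul
      (hu.push_smooth i β)).mul (hX γ)

lemma inner_smooth (hu : IsMapOn H V u U) (hX : IsFieldOn X U) (hY : IsFieldOn Y U) :
    ContDiffOn ℝ ∞ (fun q => metricInner H (u q) (X q) (Y q)) U :=
  ContDiffOn.sum fun i _ => ContDiffOn.sum fun j _ =>
    ((hu.contDiffOn_comp (hu.metric.smooth i j)).mul (hX i)).mul (hY j)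

/-- Compatibility of the induced connection with the metric. -/
lemma pd_inner (hu : IsMapOn H V u U) (hX : IsFieldOn X U) (hY : IsFieldOn Y U) (hp : p ∈ U)
    (i : Fin m) :
    pd i (fun q => metricInner H (u q) (X q) (Y q)) p =
      metricInner H (u p) (covAlong H u i X p) (Y p) +
        metricInner H (u p) (X p) (covAlong H u i Y p) := by
  have hup := hu.mapsTo hp
  have dX := hu.differentiableAt_field hX hp
  have dY := hu.differentiableAt_field hY hp
  have dH : ∀ a b, DifferentiableAt ℝ (fun q => H (u q) a b) p := fun a b =>
    differentiableAt_of_contDiffOn hu.isOpen (hu.contDiffOn_comp (hu.metric.smooth a b)) hp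
  have hsum : pd i (fun q => metricInner H (u q) (X q) (Y q)) p = ∑ a, ∑ b,
      ((∑ c, pd c (fun q => H q a b) (u p) * push u i p c) * X p a * Y p b +
        H (u p) a b * pd i (fun q => X q a) p * Y p b +
        H (u p) a b * X p a * pd i (fun q => Y q b) p) := by
    unfold metricInner
    rw [pd_sum _ _ fun a _ => DifferentiableAt.fun_sum fun b _ => ((dH a b).fun_mul (dX a)).fun_mul (dY b)]
    refine Finset.sum_congr rfl fun a _ => ?_
    rw [pd_sum _ _ fun b _ => ((dH a b).fun_mul (dX a)).fun_mul (dY b)]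
    refine Finset.sum_congr rfl fun b _ => ?_
    rw [pd_mul _ ((dH a b).fun_mul (dX a)) (dY b), pd_mul _ (dH a b) (dX a),
      pd_comp (F := fun q => H q a b) i
        (differentiableAt_of_contDiffOn hu.metric.isOpen (hu.metric.smooth a b) hup)
        (hu.differentiableAt hp)]
    ring
  -- Pairing with `W` lowers the upper index, so only Christoffel symbols of the first kind remain
  -- and `H⁻¹` disappears.
  have hG : ∀ Z W : Fin n → ℝ, metricInner H (u p)
      (fun α => ∑ β, ∑ γ, christoffel H α β γ (u p) * push u i p β * Z γ) W =
      ∑ b, ∑ β, ∑ γ, (1 / 2) * (pd β (fun q => H q γ b) (u p) + pd γ (fun q => H q β b) (u p) -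
        pd b (fun q => H q β γ) (u p)) * push u i p β * Z γ * W b := by
    intro Z W
    simp only [← hu.metric.sum_mul_christoffel hup, metricInner, Finset.mul_sum, Finset.sum_mul]
    rw [Finset.sum_comm]
    refine Finset.sum_congr rfl fun b _ => ?_
    rw [Finset.sum_comm]
    refine Finset.sum_congr rfl fun β _ => ?_
    rw [Finset.sum_comm]
    refine Finset.sum_congr rfl fun γ _ => Finset.sum_congr rfl fun a _ => ?_
    rw [hu.metric.symm hup a b]; ring
  unfold covAlong
  rw [metricInner_add_left, hG, hu.metric.metricInner_comm hup (X p), metricInner_add_left, hG,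
    hsum]
  have hH : ∀ a b c, pd c (fun q => H q a b) (u p) = pd c (fun q => H q b a) (u p) :=
    fun a b c => pd_congr hu.metric.isOpen hup (fun q hq => hu.metric.symm hq a b) c
  have e1 : ∀ Z W : Fin n → ℝ, (∑ b, ∑ β, ∑ γ,
      (1 / 2) * (pd β (fun q => H q γ b) (u p) + pd γ (fun q => H q β b) (u p) -
        pd b (fun q => H q β γ) (u p)) * push u i p β * Z γ * W b) = ∑ a, ∑ b, ∑ c,
      (1 / 2) * (pd c (fun q => H q a b) (u p) + pd a (fun q => H q c b) (u p) -
        pd b (fun q => H q c a) (u p)) * push u i p c * Z a * W b := by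
    intro Z W
    calc _ = ∑ b, ∑ a, ∑ c,
      (1 / 2) * (pd c (fun q => H q a b) (u p) + pd a (fun q => H q c b) (u p) -
        pd b (fun q => H q c a) (u p)) * push u i p c * Z a * W b :=
          Finset.sum_congr rfl fun b _ => Finset.sum_comm
      _ = _ := Finset.sum_comm
  have e2 : ∀ Z W : Fin n → ℝ, (∑ b, ∑ β, ∑ γ,
      (1 / 2) * (pd β (fun q => H q γ b) (u p) + pd γ (fun q => H q β b) (u p) -
        pd b (fun q => H q β γ) (u p)) * push u i p β * Z γ * W b) = ∑ a, ∑ b, ∑ c,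
      (1 / 2) * (pd c (fun q => H q b a) (u p) + pd b (fun q => H q c a) (u p) -
        pd a (fun q => H q c b) (u p)) * push u i p c * Z b * W a := by
    intro Z W
    exact Finset.sum_congr rfl fun b _ => Finset.sum_comm
  rw [e1 (X p) (Y p), e2 (Y p) (X p), hu.metric.metricInner_comm hup _ (X p)]
  simp only [metricInner, ← Finset.sum_add_distrib]
  refine Finset.sum_congr rfl fun a _ => Finset.sum_congr rfl fun b _ => ?_
  -- Metric compatibility in first-kind symbols: `Γ_{b,ca} + Γ_{a,cb} = ∂_c H_{ab}`.
  have : (∑ c, pd c (fun q => H q a b) (u p) * push u i p c) * X p a * Y p b =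
      (∑ c, (1 / 2) * (pd c (fun q => H q a b) (u p) + pd a (fun q => H q c b) (u p) -
        pd b (fun q => H q c a) (u p)) * push u i p c * X p a * Y p b) +
      ∑ c, (1 / 2) * (pd c (fun q => H q b a) (u p) + pd b (fun q => H q c a) (u p) -
        pd a (fun q => H q c b) (u p)) * push u i p c * Y p b * X p a := by
    rw [← Finset.sum_add_distrib, Finset.sum_mul, Finset.sum_mul]
    refine Finset.sum_congr rfl fun c _ => ?_
    rw [hH b a c]; ring
  rw [this]; ring

/-- The induced connection is torsion free. -/
lemma covAlong_push_comm (hu : IsMapOn H V u U) (hp : p ∈ U) (i j : Fin m) (α : Fin n) :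
    covAlong H u i (push u j) p α = covAlong H u j (push u i) p α := by
  unfold covAlong
  congr 1
  · exact pd_comm hu.isOpen (hu.smooth α) hp i j
  · rw [Finset.sum_comm]
    refine Finset.sum_congr rfl fun β _ => Finset.sum_congr rfl fun γ _ => ?_
    rw [hu.metric.christoffel_symm (hu.mapsTo hp)]; ring

/-- The commutator of covariant derivatives along a map is the curvature. -/
lemma covAlong_commutator (hu : IsMapOn H V u U) (hX : IsFieldOn X U) (hp : p ∈ U) (i j : Fin m)
    (α : Fin n) :
    covAlong H u i (covAlong H u j X) p α - covAlong H u j (covAlong H u i X) p α =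
      curvatureOperator H (u p) (push u i p) (push u j p) (X p) α := by
  have hup := hu.mapsTo hp
  have dX := hu.differentiableAt_field hX hp
  have dP := fun i => hu.differentiableAt_field (hu.push_smooth i) hp
  have dC : ∀ a b c, DifferentiableAt ℝ (fun q => christoffel H a b c (u q)) p := fun a b c =>
    differentiableAt_of_contDiffOn hu.isOpen
      (hu.contDiffOn_comp (hu.metric.contDiffOn_christoffel a b c)) hp
  have dPdX : ∀ i, DifferentiableAt ℝ (pd i (fun q => X q α)) p := fun i =>
    differentiableAt_of_contDiffOn hu.isOpen (contDiffOn_pd hu.isOpen (hX α) i) hp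
  -- The grouping isolates what is symmetric in `i` and `j` (second derivatives of `X`, and the
  -- terms of the first double sum taken together). These cancel in the commutator, and the `∂Γ` and
  -- `ΓΓ` sums are the curvature.
  have key : ∀ i j, covAlong H u i (covAlong H u j X) p α =
      pd i (pd j (fun q => X q α)) p +
      (∑ β, ∑ γ, (christoffel H α β γ (u p) * pd i (fun q => push u j q β) p * X p γ +
        christoffel H α β γ (u p) * push u j p β * pd i (fun q => X q γ) p +
        christoffel H α β γ (u p) * push u i p β * pd j (fun q => X q γ) p)) +
      (∑ γ, ∑ b, ∑ c, pd b (christoffel H α c γ) (u p) * push u i p b * push u j p c * X p γ) +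
      ∑ γ, ∑ b, ∑ c, ∑ a, christoffel H α b a (u p) * christoffel H a c γ (u p) *
        push u i p b * push u j p c * X p γ := by
    intro i j
    have h1 : pd i (fun q => covAlong H u j X q α) p = pd i (pd j (fun q => X q α)) p +
        ∑ β, ∑ γ, ((∑ b, pd b (christoffel H α β γ) (u p) * push u i p b) * push u j p β * X p γ +
          christoffel H α β γ (u p) * pd i (fun q => push u j q β) p * X p γ +
          christoffel H α β γ (u p) * push u j p β * pd i (fun q => X q γ) p) := by
      unfold covAlong
      rw [pd_add i (dPdX j) (DifferentiableAt.fun_sum fun β _ => DifferentiableAt.fun_sum fun γ _ =>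
        ((dC α β γ).fun_mul (dP j β)).fun_mul (dX γ))]
      congr 1
      rw [pd_sum _ _ fun β _ => DifferentiableAt.fun_sum fun γ _ =>
        ((dC α β γ).fun_mul (dP j β)).fun_mul (dX γ)]
      refine Finset.sum_congr rfl fun β _ => ?_
      rw [pd_sum _ _ fun γ _ => ((dC α β γ).fun_mul (dP j β)).fun_mul (dX γ)]
      refine Finset.sum_congr rfl fun γ _ => ?_
      rw [pd_mul _ ((dC α β γ).fun_mul (dP j β)) (dX γ), pd_mul _ (dC α β γ) (dP j β),
        pd_comp i (differentiableAt_of_contDiffOn hu.metric.isOpen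
          (hu.metric.contDiffOn_christoffel α β γ) hup) (hu.differentiableAt hp)]
      ring
    have h2 : covAlong H u i (covAlong H u j X) p α = pd i (fun q => covAlong H u j X q α) p +
        ∑ β, ∑ γ, christoffel H α β γ (u p) * push u i p β * covAlong H u j X p γ := rfl
    have h3 : ∑ β, ∑ γ, christoffel H α β γ (u p) * push u i p β * covAlong H u j X p γ =
        (∑ β, ∑ γ, christoffel H α β γ (u p) * push u i p β * pd j (fun q => X q γ) p) +
        ∑ γ, ∑ b, ∑ c, ∑ a, christoffel H α b a (u p) * christoffel H a c γ (u p) *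
          push u i p b * push u j p c * X p γ := by
      unfold covAlong
      simp only [mul_add, Finset.sum_add_distrib]
      congr 1
      simp only [Finset.mul_sum]
      calc _ = ∑ b, ∑ γ, ∑ c, ∑ a, christoffel H α b a (u p) * christoffel H a c γ (u p) *
          push u i p b * push u j p c * X p γ := by
            refine Finset.sum_congr rfl fun b _ => ?_
            rw [Finset.sum_comm_cycle]
            refine Finset.sum_congr rfl fun γ _ => ?_
            rw [Finset.sum_comm]
            exact Finset.sum_congr rfl fun _ _ => Finset.sum_congr rfl fun _ _ => by ring
        _ = _ := Finset.sum_comm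
    have h4 : ∑ β, ∑ γ, (∑ b, pd b (christoffel H α β γ) (u p) * push u i p b) *
        push u j p β * X p γ = ∑ γ, ∑ b, ∑ c, pd b (christoffel H α c γ) (u p) *
          push u i p b * push u j p c * X p γ := by
      rw [Finset.sum_comm]
      refine Finset.sum_congr rfl fun γ _ => ?_
      rw [Finset.sum_comm]
      refine Finset.sum_congr rfl fun c _ => ?_
      rw [Finset.sum_mul, Finset.sum_mul]
    rw [h2, h1, h3]
    simp only [Finset.sum_add_distrib] at h4 ⊢
    rw [h4]
    ring
  have s1 : ∑ γ, ∑ b, ∑ c, pd b (christoffel H α c γ) (u p) * push u j p b * push u i p c * X p γ =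
      ∑ γ, ∑ b, ∑ c, pd c (christoffel H α b γ) (u p) * push u i p b * push u j p c * X p γ := by
    refine Finset.sum_congr rfl fun γ _ => ?_
    rw [Finset.sum_comm]
    exact Finset.sum_congr rfl fun _ _ => Finset.sum_congr rfl fun _ _ => by ring
  have s2 : ∑ γ, ∑ b, ∑ c, ∑ a, christoffel H α b a (u p) * christoffel H a c γ (u p) *
        push u j p b * push u i p c * X p γ = ∑ γ, ∑ b, ∑ c, ∑ a, christoffel H α c a (u p) *
        christoffel H a b γ (u p) * push u i p b * push u j p c * X p γ := by
    refine Finset.sum_congr rfl fun γ _ => ?_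
    rw [Finset.sum_comm]
    exact Finset.sum_congr rfl fun _ _ => Finset.sum_congr rfl fun _ _ =>
      Finset.sum_congr rfl fun _ _ => by ring
  have s3 : ∀ β, pd i (fun q => push u j q β) p = pd j (fun q => push u i q β) p :=
    fun β => pd_comm hu.isOpen (hu.smooth β) hp i j
  have s4 : ∑ β, ∑ γ, (christoffel H α β γ (u p) * pd i (fun q => push u j q β) p * X p γ +
        christoffel H α β γ (u p) * push u j p β * pd i (fun q => X q γ) p +
        christoffel H α β γ (u p) * push u i p β * pd j (fun q => X q γ) p) =
      ∑ β, ∑ γ, (christoffel H α β γ (u p) * pd j (fun q => push u i q β) p * X p γ +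
        christoffel H α β γ (u p) * push u i p β * pd j (fun q => X q γ) p +
        christoffel H α β γ (u p) * push u j p β * pd i (fun q => X q γ) p) :=
    Finset.sum_congr rfl fun β _ => Finset.sum_congr rfl fun γ _ => by rw [s3]; ring
  rw [key i j, key j i, pd_comm hu.isOpen (hX α) hp i j, s4, s1, s2]
  have e : ∀ A B C D E F : ℝ, A + B + C + D - (A + B + E + F) = (C - E) + (D - F) := by
    intros; ring
  rw [e]
  unfold curvatureOperator curvatureComponent
  simp only [← Finset.sum_sub_distrib, ← Finset.sum_add_distrib]
  refine Finset.sum_congr rfl fun γ _ => Finset.sum_congr rfl fun b _ =>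
    Finset.sum_congr rfl fun c _ => ?_
  simp only [add_mul, Finset.sum_mul]
  congr 1
  · ring
  · exact Finset.sum_congr rfl fun _ _ => by ring

end IsMapOn

end CovAlong

/-! ### Symmetries of the curvature tensor -/

section Curvature

variable {H : Coord n → Matrix (Fin n) (Fin n) ℝ} {V : Set (Coord n)} {p : Coord n}

/-- The affine map through `p` in the directions `Z i`. -/
def affineMap {k : ℕ} (p : Coord n) (Z : Fin k → Fin n → ℝ) (x : Coord k) : Coord n :=
  WithLp.toLp 2 fun α => p α + ∑ i, x i * Z i α

lemma affineMap_zero {k : ℕ} (Z : Fin k → Fin n → ℝ) : affineMap p Z 0 = p := by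
  ext α; simp [affineMap]

lemma contDiff_affineMap {k : ℕ} (Z : Fin k → Fin n → ℝ) (α : Fin n) :
    ContDiff ℝ ∞ (fun x => affineMap p Z x α) := by
  unfold affineMap
  fun_prop

lemma push_affineMap {k : ℕ} (Z : Fin k → Fin n → ℝ) (i : Fin k) (q : Coord k) :
    push (affineMap p Z) i q = Z i := by
  ext α
  have hd : ∀ j : Fin k, DifferentiableAt ℝ (fun x : Coord k => x j * Z j α) q := by
    intro j; fun_prop
  have h1 : ∀ j : Fin k, pd i (fun x : Coord k => x j * Z j α) q = if j = i then Z j α else 0 := by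
    intro j
    have : HasFDerivAt (fun x : Coord k => x j * Z j α)
        ((Z j α) • (EuclideanSpace.proj j : Coord k →L[ℝ] ℝ)) q :=
      (EuclideanSpace.proj j : Coord k →L[ℝ] ℝ).hasFDerivAt.mul_const _
    rw [pd, this.fderiv]
    simp
  change pd i (fun x : Coord k => p α + ∑ j, x j * Z j α) q = Z i α
  rw [pd_add _ (differentiableAt_const _) (DifferentiableAt.fun_sum fun j _ => hd j),
    pd_const, pd_sum _ _ fun j _ => hd j]
  simp [h1]

lemma isMapOn_affineMap {k : ℕ} (hH : IsMetricOn H V) (Z : Fin k → Fin n → ℝ) :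
    IsMapOn H V (affineMap p Z) (affineMap p Z ⁻¹' V) where
  metric := hH
  isOpen := hH.isOpen.preimage
    (contDiff_euclidean.2 (contDiff_affineMap (p := p) Z)).continuous
  smooth α := (contDiff_affineMap Z α).contDiffOn
  mapsTo := Set.mapsTo_preimage _ _

lemma curvatureOperator_swap (X Y Z : Fin n → ℝ) (l : Fin n) :
    curvatureOperator H p X Y Z l = -curvatureOperator H p Y X Z l := by
  unfold curvatureOperator
  simp only [← Finset.sum_neg_distrib]
  refine Finset.sum_congr rfl fun k _ => ?_
  rw [Finset.sum_comm]
  refine Finset.sum_congr rfl fun i _ => Finset.sum_congr rfl fun j _ => ?_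
  have : curvatureComponent H l k j i p = -curvatureComponent H l k i j p := by
    unfold curvatureComponent
    rw [neg_add, neg_sub, ← Finset.sum_neg_distrib]
    simp only [neg_sub]
  rw [this]; ring

/-- The curvature operator is skew-adjoint. -/
lemma IsMetricOn.inner_curvature_skew (hH : IsMetricOn H V) (hp : p ∈ V) (X Y Z W : Fin n → ℝ) :
    metricInner H p (curvatureOperator H p X Y Z) W =
      -metricInner H p (curvatureOperator H p X Y W) Z := by
  set u := affineMap p ![X, Y] with hu_def
  have hu : IsMapOn H V u (u ⁻¹' V) := isMapOn_affineMap hH _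
  have hu0 : u 0 = p := affineMap_zero _
  have h0 : (0 : Coord 2) ∈ u ⁻¹' V := by simpa [hu0] using hp
  -- Vectors are extended by constant coordinates along an affine plane tangent to `X` and `Y`, so
  -- that the curvature becomes a commutator of covariant derivatives.
  have hc : ∀ T : Fin n → ℝ, IsFieldOn (fun _ : Coord 2 => T) (u ⁻¹' V) :=
    fun T α => contDiffOn_const
  have hcomm : ∀ T : Fin n → ℝ, curvatureOperator H p X Y T = fun α =>
      covAlong H u 0 (covAlong H u 1 fun _ => T) 0 α -
        covAlong H u 1 (covAlong H u 0 fun _ => T) 0 α := by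
    intro T
    ext α
    rw [hu.covAlong_commutator (hc T) h0 0 1 α, hu0, hu_def, push_affineMap, push_affineMap]
    rfl
  have h2 : ∀ i j : Fin 2, pd i (pd j fun q => metricInner H (u q) Z W) 0 =
      metricInner H p (covAlong H u i (covAlong H u j fun _ => Z) 0) W +
      metricInner H p (covAlong H u j (fun _ => Z) 0) (covAlong H u i (fun _ => W) 0) +
      (metricInner H p (covAlong H u i (fun _ => Z) 0) (covAlong H u j (fun _ => W) 0) +
      metricInner H p Z (covAlong H u i (covAlong H u j fun _ => W) 0)) := by
    intro i j
    have e : ∀ q ∈ u ⁻¹' V, pd j (fun q => metricInner H (u q) Z W) q =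
        metricInner H (u q) (covAlong H u j (fun _ => Z) q) W +
          metricInner H (u q) Z (covAlong H u j (fun _ => W) q) := fun q hq =>
      hu.pd_inner (hc Z) (hc W) hq j
    have sZ := hu.covAlong_smooth (hc Z) j
    have sW := hu.covAlong_smooth (hc W) j
    rw [pd_congr hu.isOpen h0 e,
      pd_add i (differentiableAt_of_contDiffOn hu.isOpen (hu.inner_smooth sZ (hc W)) h0)
        (differentiableAt_of_contDiffOn hu.isOpen (hu.inner_smooth (hc Z) sW) h0),
      hu.pd_inner sZ (hc W) h0, hu.pd_inner (hc Z) sW h0, hu0]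
  -- Mixed partials of `⟨Z, W⟩` agree. The products of first derivatives cancel, leaving the two
  -- curvature terms.
  have h3 := pd_comm hu.isOpen (hu.inner_smooth (hc Z) (hc W)) h0 0 1
  rw [h2, h2] at h3
  rw [hcomm, hcomm, metricInner_sub_left, metricInner_sub_left,
    hH.metricInner_comm hp _ Z, hH.metricInner_comm hp _ Z]
  linarith

/-- The first Bianchi identity. -/
lemma IsMetricOn.bianchi (hH : IsMetricOn H V) (hp : p ∈ V) (X Y Z : Fin n → ℝ) (α : Fin n) :
    curvatureOperator H p X Y Z α + curvatureOperator H p Y Z X α +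
      curvatureOperator H p Z X Y α = 0 := by
  set u := affineMap p ![X, Y, Z] with hu_def
  have hu : IsMapOn H V u (u ⁻¹' V) := isMapOn_affineMap hH _
  have hu0 : u 0 = p := affineMap_zero _
  have h0 : (0 : Coord 3) ∈ u ⁻¹' V := by simpa [hu0] using hp
  have hcomm : ∀ i j k : Fin 3, curvatureOperator H p (![X, Y, Z] i) (![X, Y, Z] j)
      (![X, Y, Z] k) α = covAlong H u i (covAlong H u j (push u k)) 0 α -
        covAlong H u j (covAlong H u i (push u k)) 0 α := by
    intro i j k
    rw [hu.covAlong_commutator (hu.push_smooth k) h0 i j α, hu0, hu_def, push_affineMap,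
      push_affineMap, push_affineMap]
  -- Torsion-freeness pairs off the six second derivatives in the cyclic sum.
  have hs : ∀ i j k : Fin 3, covAlong H u i (covAlong H u j (push u k)) 0 α =
      covAlong H u i (covAlong H u k (push u j)) 0 α := fun i j k =>
    covAlong_congr hu.isOpen h0 (fun q hq β => hu.covAlong_push_comm hq j k β) i α
  have e1 := hcomm 0 1 2
  have e2 := hcomm 1 2 0
  have e3 := hcomm 2 0 1
  simp only [Matrix.cons_val] at e1 e2 e3
  rw [e1, e2, e3, hs 0 1 2, hs 1 2 0, hs 2 0 1]
  ring

/-- The pair symmetry of the curvature tensor. -/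
lemma IsMetricOn.inner_curvature_pair (hH : IsMetricOn H V) (hp : p ∈ V) (X Y Z W : Fin n → ℝ) :
    metricInner H p (curvatureOperator H p X Y Z) W =
      metricInner H p (curvatureOperator H p Z W X) Y := by
  have skew := hH.inner_curvature_skew hp
  have swap : ∀ X Y Z W : Fin n → ℝ, metricInner H p (curvatureOperator H p X Y Z) W =
      -metricInner H p (curvatureOperator H p Y X Z) W := by
    intro X Y Z W
    have : curvatureOperator H p X Y Z = fun l => (-1) * curvatureOperator H p Y X Z l := by
      ext l; rw [curvatureOperator_swap]; ring
    rw [this, metricInner_smul_left]; ring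
  have bian : ∀ X Y Z W : Fin n → ℝ, metricInner H p (curvatureOperator H p X Y Z) W +
      metricInner H p (curvatureOperator H p Y Z X) W +
      metricInner H p (curvatureOperator H p Z X Y) W = 0 := by
    intro X Y Z W
    rw [← metricInner_add_left, ← metricInner_add_left]
    have : (fun α => curvatureOperator H p X Y Z α + curvatureOperator H p Y Z X α +
      curvatureOperator H p Z X Y α) = fun _ => 0 := funext fun α => hH.bianchi hp X Y Z α
    rw [this]; simp [metricInner]
  -- The usual octahedron argument: four Bianchi identities combined through the two antisymmetries.
  linarith [bian X Y Z W, bian Y Z W X, bian Z W X Y, bian W X Y Z, skew X Y Z W, skew Y Z X W,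
    skew Z X Y W, skew Y Z W X, skew Z W Y X, skew W Y Z X, skew Z W X Y, skew W X Z Y,
    skew X Z W Y, skew W X Y Z, skew X Y W Z, skew Y W X Z,
    swap X Y Z W, swap Y Z X W, swap Z X Y W, swap Y Z W X, swap Z W Y X, swap W Y Z X,
    swap Z W X Y, swap W X Z Y, swap X Z W Y, swap W X Y Z, swap X Y W Z, swap Y W X Z]

lemma curvatureOperator_sum_left {ι : Type*} (s : Finset ι) (c : ι → ℝ) (X : ι → Fin n → ℝ)
    (Y Z : Fin n → ℝ) (l : Fin n) :
    curvatureOperator H p (fun α => ∑ a ∈ s, c a * X a α) Y Z l =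
      ∑ a ∈ s, c a * curvatureOperator H p (X a) Y Z l := by
  unfold curvatureOperator
  simp only [Finset.mul_sum, Finset.sum_mul]
  rw [Finset.sum_comm' (t' := Finset.univ) (s' := fun _ => s) (by simp)]
  refine Finset.sum_congr rfl fun k _ => ?_
  rw [Finset.sum_comm' (t' := Finset.univ) (s' := fun _ => s) (by simp)]
  refine Finset.sum_congr rfl fun i _ => ?_
  rw [Finset.sum_comm' (t' := Finset.univ) (s' := fun _ => s) (by simp)]
  exact Finset.sum_congr rfl fun j _ => Finset.sum_congr rfl fun a _ => by ring

lemma curvatureOperator_sum_right {ι : Type*} (s : Finset ι) (c : ι → ℝ) (Z : ι → Fin n → ℝ)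
    (X Y : Fin n → ℝ) (l : Fin n) :
    curvatureOperator H p X Y (fun α => ∑ a ∈ s, c a * Z a α) l =
      ∑ a ∈ s, c a * curvatureOperator H p X Y (Z a) l := by
  unfold curvatureOperator
  simp only [Finset.mul_sum]
  rw [Finset.sum_comm' (t' := Finset.univ) (s' := fun _ => s) (by simp)]
  refine Finset.sum_congr rfl fun k _ => ?_
  rw [Finset.sum_comm' (t' := Finset.univ) (s' := fun _ => s) (by simp)]
  refine Finset.sum_congr rfl fun i _ => ?_
  rw [Finset.sum_comm' (t' := Finset.univ) (s' := fun _ => s) (by simp)]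
  exact Finset.sum_congr rfl fun j _ => Finset.sum_congr rfl fun a _ => by ring

/-- Nonpositive sectional curvature, expressed without the denominator. -/
lemma IsMetricOn.inner_curvature_nonpos (hH : IsMetricOn H V) (hp : p ∈ V)
    (hsec : ∀ X Y : Fin n → ℝ, LinearIndependent ℝ ![X, Y] → sectionalCurvature H p X Y ≤ 0)
    (X Y : Fin n → ℝ) : metricInner H p (curvatureOperator H p X Y Y) X ≤ 0 := by
  by_cases hli : LinearIndependent ℝ ![X, Y]
  · have hY : Y ≠ 0 := by simpa using hli.ne_zero 1
    have hYY := hH.metricInner_self_pos hp hY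
    have hden : 0 < metricInner H p X X * metricInner H p Y Y - metricInner H p X Y ^ 2 := by
      -- Strict Cauchy–Schwarz: `X - tY` is the component of `X` orthogonal to `Y`, nonzero by
      -- independence.
      set t := metricInner H p X Y / metricInner H p Y Y with ht
      have hne : (fun α => X α - t * Y α) ≠ 0 := by
        intro h0
        have := (LinearIndependent.pair_iff.1 hli) 1 (-t) (by
          ext α
          have := congrFun h0 α
          simp only [Pi.zero_apply] at this
          simp only [Pi.add_apply, Pi.smul_apply, smul_eq_mul, Pi.zero_apply]
          linarith)
        simp at this
      have hpos := hH.metricInner_self_pos hp hne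
      rw [metricInner_sub_left, metricInner_smul_left, hH.metricInner_comm hp X,
        hH.metricInner_comm hp Y, metricInner_sub_left, metricInner_sub_left,
        metricInner_smul_left, metricInner_smul_left, hH.metricInner_comm hp Y X] at hpos
      have hty : t * metricInner H p Y Y = metricInner H p X Y := by
        rw [ht]; field_simp
      have := mul_pos hpos hYY
      nlinarith
    have := hsec X Y hli
    rw [sectionalCurvature, div_le_iff₀ hden, zero_mul] at this
    exact this
  · refine le_of_eq ?_
    have skew := hH.inner_curvature_skew hp
    by_cases hY : Y = 0
    · simp [hY, metricInner, curvatureOperator]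
    · have : ¬ ∀ s t : ℝ, s • X + t • Y = 0 → s = 0 ∧ t = 0 := by
        rwa [← LinearIndependent.pair_iff]
      push Not at this
      obtain ⟨s, t, hst, hne⟩ := this
      have hs : s ≠ 0 := by
        rintro rfl
        have ht := hne rfl
        simp only [zero_smul, zero_add, smul_eq_zero] at hst
        exact hst.elim ht hY
      have hX : X = fun α => (-t / s) * Y α := by
        ext α
        have := congrFun hst α
        simp only [Pi.add_apply, Pi.smul_apply, smul_eq_mul, Pi.zero_apply] at this
        field_simp
        linarith
      rw [hH.metricInner_comm hp, hX, metricInner_smul_left, hH.metricInner_comm hp]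
      -- With equal last arguments, skewness says that the quantity equals its own negative.
      have := skew (fun α => (-t / s) * Y α) Y Y Y
      have h0 : metricInner H p (curvatureOperator H p (fun α => (-t / s) * Y α) Y Y) Y = 0 := by
        linarith
      rw [h0, mul_zero]

end Curvature

/-! ### Traces of positive semidefinite forms -/

/-- Writing `A = Bᵀ B` turns the trace into a sum of diagonal values of `S`; this replaces the
choice of an orthonormal frame. It is applied with `A = G⁻¹`, both to the curvature form and to the
metric itself. -/
lemma trace_form_nonneg {A : Matrix (Fin m) (Fin m) ℝ} (hA : A.PosSemidef)
    (S : (Fin n → ℝ) → (Fin n → ℝ) → ℝ)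
    (hleft : ∀ (c : Fin m → ℝ) (X : Fin m → Fin n → ℝ) Y,
      S (fun α => ∑ i, c i * X i α) Y = ∑ i, c i * S (X i) Y)
    (hright : ∀ X (c : Fin m → ℝ) (Y : Fin m → Fin n → ℝ),
      S X (fun α => ∑ i, c i * Y i α) = ∑ i, c i * S X (Y i))
    (hS : ∀ X, 0 ≤ S X X) (X : Fin m → Fin n → ℝ) :
    0 ≤ ∑ i, ∑ j, A i j * S (X i) (X j) := by
  obtain ⟨B, rfl⟩ : ∃ B : Matrix (Fin m) (Fin m) ℝ, A = B.conjTranspose * B := by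
    open scoped MatrixOrder in
    exact CStarAlgebra.nonneg_iff_eq_star_mul_self.1 hA.nonneg
  have : ∑ i, ∑ j, (B.conjTranspose * B) i j * S (X i) (X j) =
      ∑ k, S (fun α => ∑ i, B k i * X i α) (fun α => ∑ i, B k i * X i α) := by
    simp only [hleft, hright, Matrix.mul_apply, Matrix.conjTranspose_apply, star_trivial,
      Finset.mul_sum, Finset.sum_mul]
    rw [Finset.sum_comm_cycle]
    refine Finset.sum_congr rfl fun k _ => Finset.sum_congr rfl fun i _ =>
      Finset.sum_congr rfl fun j _ => by ring
  rw [this]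
  exact Finset.sum_nonneg fun k _ => hS _

/-! ### Umbilical maps -/

/-- `u` is an isometric immersion of the metric `G` on `U` into the metric `H` on `V` whose second
fundamental form is `G ⊗ η`. -/
structure IsUmbilicOn (G : Coord m → Matrix (Fin m) (Fin m) ℝ)
    (H : Coord n → Matrix (Fin n) (Fin n) ℝ) (V : Set (Coord n)) (u : Coord m → Coord n)
    (η : Coord m → Fin n → ℝ) (U : Set (Coord m)) : Prop extends IsMapOn H V u U where
  metricSource : IsMetricOn G U
  isometric : ∀ q ∈ U, ∀ j k, G q j k = metricInner H (u q) (push u j q) (push u k q)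
  normal_smooth : IsFieldOn η U
  umbilic : ∀ q ∈ U, ∀ i j α, covAlong H u i (push u j) q α =
    (∑ k, christoffel G k i j q * push u k q α) + G q i j * η q α

namespace IsUmbilicOn

variable {G : Coord m → Matrix (Fin m) (Fin m) ℝ} {H : Coord n → Matrix (Fin n) (Fin n) ℝ}
  {V : Set (Coord n)} {u : Coord m → Coord n} {η w : Coord m → Fin n → ℝ} {U : Set (Coord m)}
  {p : Coord m}

lemma inner_covAlong_push (hu : IsUmbilicOn G H V u η U) (hp : p ∈ U) (i j : Fin m)
    (W : Fin n → ℝ) :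
    metricInner H (u p) (covAlong H u i (push u j) p) W =
      (∑ k, christoffel G k i j p * metricInner H (u p) (push u k p) W) +
        G p i j * metricInner H (u p) (η p) W := by
  have : covAlong H u i (push u j) p = fun α =>
    (∑ k, christoffel G k i j p * push u k p α) + G p i j * η p α :=
      funext fun α => hu.umbilic p hp i j α
  rw [this, metricInner_add_left, metricInner_smul_left, metricInner_sum_left]
  simp only [metricInner_smul_left]

lemma pd_metric (hu : IsUmbilicOn G H V u η U) (hp : p ∈ U) (i j k : Fin m) :
    pd i (fun q => G q j k) p = metricInner H (u p) (covAlong H u i (push u j) p) (push u k p) +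
      metricInner H (u p) (covAlong H u i (push u k) p) (push u j p) := by
  rw [pd_congr hu.isOpen hp fun q hq => hu.isometric q hq j k,
    hu.pd_inner (hu.push_smooth j) (hu.push_smooth k) hp,
    hu.metric.metricInner_comm (hu.mapsTo hp) (push u j p)]

/-- Koszul's formula: metric compatibility and torsion-freeness of the induced connection make its
tangential part the Levi-Civita connection of `G`. -/
lemma koszul (hu : IsUmbilicOn G H V u η U) (hp : p ∈ U) (i j k : Fin m) :
    metricInner H (u p) (covAlong H u i (push u j) p) (push u k p) =
      ∑ l, G p k l * christoffel G l i j p := by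
  have hs : ∀ a b, covAlong H u a (push u b) p = covAlong H u b (push u a) p :=
    fun a b => funext fun α => hu.covAlong_push_comm hp a b α
  rw [hu.metricSource.sum_mul_christoffel hp, hu.pd_metric hp, hu.pd_metric hp, hu.pd_metric hp,
    hs j i, hs k i, hs k j]
  ring

/-- `IsUmbilicOn` does not postulate that `η` is normal. It follows by comparing `umbilic` with
`koszul` at `i = j = k`, where the coefficient `G p k k` is positive. -/
lemma inner_normal_push (hu : IsUmbilicOn G H V u η U) (hp : p ∈ U) (k : Fin m) :
    metricInner H (u p) (η p) (push u k p) = 0 := by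
  have h1 := hu.koszul hp k k k
  rw [hu.inner_covAlong_push hp] at h1
  have h2 : ∑ l, christoffel G l k k p * metricInner H (u p) (push u l p) (push u k p) =
      ∑ l, G p k l * christoffel G l k k p :=
    Finset.sum_congr rfl fun l _ => by
      rw [← hu.isometric p hp, hu.metricSource.symm hp]; ring
  have h3 : G p k k * metricInner H (u p) (η p) (push u k p) = 0 := by linarith
  exact (mul_eq_zero.1 h3).resolve_left (hu.metricSource.diag_pos hp k).ne'

/-- The tangential part of the derivative of a normal field. -/
lemma inner_covAlong_normal (hu : IsUmbilicOn G H V u η U) (hw : IsFieldOn w U)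
    (hn : ∀ q ∈ U, ∀ k, metricInner H (u q) (w q) (push u k q) = 0) (hp : p ∈ U) (i k : Fin m) :
    metricInner H (u p) (covAlong H u i w p) (push u k p) =
      -(G p i k * metricInner H (u p) (w p) (η p)) := by
  have hup := hu.mapsTo hp
  -- Weingarten: differentiate `⟨w, ∂ₖu⟩ = 0` and insert the umbilic form of `∇ᵢ∂ₖu`.
  have h0 : pd i (fun q => metricInner H (u q) (w q) (push u k q)) p = 0 := by
    rw [pd_congr hu.isOpen hp (fun q hq => hn q hq k), pd_const]
  rw [hu.pd_inner hw (hu.push_smooth k) hp, hu.metric.metricInner_comm hup (w p),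
    hu.inner_covAlong_push hp, hu.metric.metricInner_comm hup (η p)] at h0
  have : ∑ l, christoffel G l i k p * metricInner H (u p) (push u l p) (w p) = 0 :=
    Finset.sum_eq_zero fun l _ => by
      rw [hu.metric.metricInner_comm hup, hn p hp, mul_zero]
  linarith

/-- The tangential part of the Hessian of a normal field. -/
lemma inner_hessian_normal (hu : IsUmbilicOn G H V u η U) (hw : IsFieldOn w U)
    (hn : ∀ q ∈ U, ∀ k, metricInner H (u q) (w q) (push u k q) = 0) (hp : p ∈ U)
    (i j k : Fin m) :
    metricInner H (u p) (fun α => covAlong H u i (covAlong H u j w) p α -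
        ∑ l, christoffel G l i j p * covAlong H u l w p α) (push u k p) =
      -(G p j k * pd i (fun q => metricInner H (u q) (w q) (η q)) p) -
        G p i k * metricInner H (u p) (covAlong H u j w p) (η p) := by
  have hup := hu.mapsTo hp
  have hs := hu.inner_smooth hw hu.normal_smooth
  have d1 := differentiableAt_of_contDiffOn hu.isOpen hs hp
  have d2 := differentiableAt_of_contDiffOn hu.isOpen (hu.metricSource.smooth j k) hp
  set s := metricInner H (u p) (w p) (η p) with hs_def
  -- Differentiate the identity `⟨∇ⱼw, ∂ₖu⟩ = -G_{jk}⟨w, η⟩`. The Christoffel terms coming from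
  -- `∂ᵢG_{jk}`, from `∇ᵢ∂ₖu` and from the Hessian correction cancel.
  have h1 := hu.pd_inner (hu.covAlong_smooth hw j) (hu.push_smooth k) hp i
  rw [pd_congr (g := fun q => -1 * (G q j k * metricInner H (u q) (w q) (η q))) hu.isOpen hp
    (fun q hq => by rw [hu.inner_covAlong_normal hw hn hq]; ring),
    pd_mul _ (differentiableAt_const _) (d2.fun_mul d1), pd_const, pd_mul _ d2 d1,
    hu.metric.metricInner_comm hup (covAlong H u j w p), hu.inner_covAlong_push hp,
    hu.metric.metricInner_comm hup (η p), hu.pd_metric hp, hu.koszul hp, hu.koszul hp] at h1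
  have h2 : ∑ l, christoffel G l i k p *
      metricInner H (u p) (push u l p) (covAlong H u j w p) =
      -((∑ l, G p j l * christoffel G l i k p) * s) := by
    rw [Finset.sum_mul, ← Finset.sum_neg_distrib]
    refine Finset.sum_congr rfl fun l _ => ?_
    rw [hu.metric.metricInner_comm hup, hu.inner_covAlong_normal hw hn hp]; ring
  have h3 : metricInner H (u p)
      (fun α => ∑ l, christoffel G l i j p * covAlong H u l w p α) (push u k p) =
      -((∑ l, G p k l * christoffel G l i j p) * s) := by
    rw [metricInner_sum_left, Finset.sum_mul, ← Finset.sum_neg_distrib]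
    refine Finset.sum_congr rfl fun l _ => ?_
    rw [metricInner_smul_left, hu.inner_covAlong_normal hw hn hp, hu.metricSource.symm hp l k]
    ring
  rw [metricInner_sub_left, h3]
  rw [h2] at h1
  linarith

/-- The tangential part of the Ricci-type term of a normal field. -/
lemma inner_curvature_normal (hu : IsUmbilicOn G H V u η U) (hw : IsFieldOn w U)
    (hn : ∀ q ∈ U, ∀ k, metricInner H (u q) (w q) (push u k q) = 0) (hp : p ∈ U)
    (i j k : Fin m) :
    metricInner H (u p) (curvatureOperator H (u p) (push u i p) (w p) (push u j p)) (push u k p) =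
      G p k i * (pd j (fun q => metricInner H (u q) (w q) (η q)) p -
        metricInner H (u p) (covAlong H u j w p) (η p)) -
      G p j i * (pd k (fun q => metricInner H (u q) (w q) (η q)) p -
        metricInner H (u p) (covAlong H u k w p) (η p)) := by
  have hup := hu.mapsTo hp
  -- The Christoffel corrections are symmetric in `j` and `k`, so the commutator is a difference of
  -- Hessians. Pair symmetry and skewness then bring the curvature term to this form, which is the
  -- Codazzi equation.
  have hc : curvatureOperator H (u p) (push u j p) (push u k p) (w p) = fun α =>
      (covAlong H u j (covAlong H u k w) p α -
        ∑ l, christoffel G l j k p * covAlong H u l w p α) -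
      (covAlong H u k (covAlong H u j w) p α -
        ∑ l, christoffel G l k j p * covAlong H u l w p α) := by
    ext α
    rw [← hu.covAlong_commutator hw hp]
    have : ∀ l, christoffel G l j k p = christoffel G l k j p :=
      fun l => hu.metricSource.christoffel_symm hp l j k
    simp only [this]
    ring
  rw [hu.metric.inner_curvature_pair hup, hu.metric.inner_curvature_skew hup, hc,
    metricInner_sub_left, hu.inner_hessian_normal hw hn hp, hu.inner_hessian_normal hw hn hp]
  ring

/-- Traces the output of `inner_hessian_normal`, with `a` the gradient of `⟨w, η⟩` and `b` the
`η`-component of `∇w`. -/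
lemma sum_inv_mul_metric (hu : IsUmbilicOn G H V u η U) (hp : p ∈ U) (a b : Fin m → ℝ)
    (k : Fin m) :
    ∑ i, ∑ j, (G p)⁻¹ i j * (-(G p j k * a i) - G p i k * b j) = -a k - b k := by
  have h1 : ∑ i, ∑ j, (G p)⁻¹ i j * (G p j k * a i) = a k := by
    have : ∀ i, ∑ j, (G p)⁻¹ i j * (G p j k * a i) = (if i = k then 1 else 0) * a i := by
      intro i
      rw [← hu.metricSource.inv_mul hp, Finset.sum_mul]
      exact Finset.sum_congr rfl fun j _ => by ring
    simp [this]
  have h2 : ∑ i, ∑ j, (G p)⁻¹ i j * (G p i k * b j) = b k := by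
    rw [Finset.sum_comm]
    have : ∀ j, ∑ i, (G p)⁻¹ i j * (G p i k * b j) = (if j = k then 1 else 0) * b j := by
      intro j
      rw [← hu.metricSource.inv_mul hp, Finset.sum_mul]
      exact Finset.sum_congr rfl fun i _ => by rw [hu.metricSource.inv_symm hp i j]; ring
    simp [this]
  have : ∀ i j, (G p)⁻¹ i j * (-(G p j k * a i) - G p i k * b j) =
      -((G p)⁻¹ i j * (G p j k * a i)) - (G p)⁻¹ i j * (G p i k * b j) := fun i j => by ring
  simp only [this, Finset.sum_sub_distrib, Finset.sum_neg_distrib, h1, h2]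

lemma sum_inv_mul_self (hu : IsUmbilicOn G H V u η U) (hp : p ∈ U) :
    ∑ i, ∑ j, (G p)⁻¹ i j * G p j i = m := by
  simp [hu.metricSource.inv_mul hp]

end IsUmbilicOn

section JacobiField

variable {G : Coord 2 → Matrix (Fin 2) (Fin 2) ℝ} {H : Coord n → Matrix (Fin n) (Fin n) ℝ}
  {V : Set (Coord n)} {u : Coord 2 → Coord n} {η w : Coord 2 → Fin n → ℝ} {U : Set (Coord 2)}
  {p : Coord 2}

lemma metricInner_double_sum {p : Coord n} (A : Matrix (Fin m) (Fin m) ℝ)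
    (X : Fin m → Fin m → Fin n → ℝ) (Z : Fin n → ℝ) :
    metricInner H p (fun α => ∑ i, ∑ j, A i j * X i j α) Z =
      ∑ i, ∑ j, A i j * metricInner H p (X i j) Z := by
  rw [metricInner_sum_left]
  refine Finset.sum_congr rfl fun i _ => ?_
  rw [metricInner_sum_left]
  exact Finset.sum_congr rfl fun j _ => metricInner_smul_left _ _ _

lemma inner_roughLaplacian (Z : Fin n → ℝ) :
    metricInner H (u p) (roughLaplacian G H u w p) Z = ∑ i, ∑ j, (G p)⁻¹ i j *
      metricInner H (u p) (fun α => covAlong H u i (covAlong H u j w) p α -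
        ∑ l, christoffel G l i j p * covAlong H u l w p α) Z :=
  metricInner_double_sum _ _ _

/-- A normal Jacobi field along an umbilical surface has derivative orthogonal to the mean
curvature vector. -/
lemma IsUmbilicOn.inner_covAlong_eq_zero (hu : IsUmbilicOn G H V u η U) (hw : IsFieldOn w U)
    (hn : ∀ q ∈ U, ∀ k, metricInner H (u q) (w q) (push u k q) = 0)
    (hjac : ∀ q ∈ U, ∀ α, roughLaplacian G H u w q α = ∑ i, ∑ j, (G q)⁻¹ i j *
      curvatureOperator H (u q) (push u i q) (w q) (push u j q) α) (hp : p ∈ U) (k : Fin 2) :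
    metricInner H (u p) (covAlong H u k w p) (η p) = 0 := by
  have h1 := inner_roughLaplacian (G := G) (H := H) (u := u) (w := w) (p := p) (push u k p)
  rw [show roughLaplacian G H u w p = _ from funext (hjac p hp), metricInner_double_sum] at h1
  simp only [hu.inner_hessian_normal hw hn hp, hu.inner_curvature_normal hw hn hp] at h1
  rw [hu.sum_inv_mul_metric hp
    (fun i => pd i (fun q => metricInner H (u q) (w q) (η q)) p)
    (fun j => metricInner H (u p) (covAlong H u j w p) (η p))] at h1
  set v : Fin 2 → ℝ := fun j => pd j (fun q => metricInner H (u q) (w q) (η q)) p -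
    metricInner H (u p) (covAlong H u j w p) (η p) with hv
  -- The `2` is the dimension of the source. Only for this value does `∂ₖ⟨w, η⟩` drop out of `h1`.
  have h2 : ∑ i, ∑ j, (G p)⁻¹ i j * (G p k i * v j - G p j i * v k) = v k - 2 * v k := by
    have e1 : ∑ i, ∑ j, (G p)⁻¹ i j * (G p k i * v j) = v k := by
      rw [Finset.sum_comm]
      have : ∀ j, ∑ i, (G p)⁻¹ i j * (G p k i * v j) = (if k = j then 1 else 0) * v j := by
        intro j
        rw [← hu.metricSource.mul_inv hp, Finset.sum_mul]
        exact Finset.sum_congr rfl fun i _ => by ring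
      simp [this]
    have e2 : ∑ i, ∑ j, (G p)⁻¹ i j * (G p j i * v k) = 2 * v k := by
      simp only [← mul_assoc, ← Finset.sum_mul, hu.sum_inv_mul_self hp, Nat.cast_ofNat]
    simp only [mul_sub, Finset.sum_sub_distrib, e1, e2]
  rw [h2] at h1
  simp only [hv] at h1
  linarith

/-- An umbilical surface in a nonpositively curved manifold which carries a Jacobi field that is a
nowhere vanishing multiple of its mean curvature vector is totally geodesic. -/
lemma IsUmbilicOn.normal_eq_zero (hu : IsUmbilicOn G H V u η U) (hw : IsFieldOn w U)
    {f : Coord 2 → ℝ} (hf : ∀ q ∈ U, f q ≠ 0) (hwη : ∀ q ∈ U, ∀ α, w q α = f q * η q α)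
    (hjac : ∀ q ∈ U, ∀ α, roughLaplacian G H u w q α = ∑ i, ∑ j, (G q)⁻¹ i j *
      curvatureOperator H (u q) (push u i q) (w q) (push u j q) α)
    (hsec : ∀ y ∈ V, ∀ X Y : Fin n → ℝ, LinearIndependent ℝ ![X, Y] →
      sectionalCurvature H y X Y ≤ 0) (hp : p ∈ U) : η p = 0 := by
  have hup := hu.mapsTo hp
  have hwη' : ∀ q ∈ U, w q = fun α => f q * η q α := fun q hq => funext (hwη q hq)
  have hn : ∀ q ∈ U, ∀ k, metricInner H (u q) (w q) (push u k q) = 0 := by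
    intro q hq k
    rw [hwη' q hq, metricInner_smul_left, hu.inner_normal_push hq, mul_zero]
  -- Needed on all of `U`, not only at `p`, because `hDDw` differentiates it.
  have hDw : ∀ q ∈ U, ∀ k, metricInner H (u q) (covAlong H u k w q) (w q) = 0 := by
    intro q hq k
    rw [hu.metric.metricInner_comm (hu.mapsTo hq), hwη' q hq, metricInner_smul_left,
      hu.metric.metricInner_comm (hu.mapsTo hq), hu.inner_covAlong_eq_zero hw hn hjac hq, mul_zero]
  have hDDw : ∀ i j, metricInner H (u p) (fun α => covAlong H u i (covAlong H u j w) p α -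
        ∑ l, christoffel G l i j p * covAlong H u l w p α) (w p) =
      -metricInner H (u p) (covAlong H u i w p) (covAlong H u j w p) := by
    intro i j
    have h1 := hu.pd_inner (hu.covAlong_smooth hw j) hw hp i
    rw [pd_congr hu.isOpen hp (fun q hq => hDw q hq j), pd_const,
      hu.metric.metricInner_comm hup (covAlong H u j w p)] at h1
    have h2 : metricInner H (u p)
        (fun α => ∑ l, christoffel G l i j p * covAlong H u l w p α) (w p) = 0 := by
      rw [metricInner_sum_left]
      exact Finset.sum_eq_zero fun l _ => by rw [metricInner_smul_left, hDw p hp, mul_zero]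
    rw [metricInner_sub_left, h2]
    linarith
  have h1 := inner_roughLaplacian (G := G) (H := H) (u := u) (w := w) (p := p) (w p)
  rw [show roughLaplacian G H u w p = _ from funext (hjac p hp), metricInner_double_sum] at h1
  simp only [hDDw] at h1
  have hinv : (G p)⁻¹.PosSemidef := (hu.metricSource.posDef p hp).inv.posSemidef
  have innerL : ∀ (c : Fin 2 → ℝ) (X : Fin 2 → Fin n → ℝ) Y, metricInner H (u p)
      (fun α => ∑ i, c i * X i α) Y = ∑ i, c i * metricInner H (u p) (X i) Y := by
    intro c X Y
    rw [metricInner_sum_left]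
    exact Finset.sum_congr rfl fun i _ => metricInner_smul_left _ _ _
  have innerR : ∀ X (c : Fin 2 → ℝ) (Y : Fin 2 → Fin n → ℝ), metricInner H (u p) X
      (fun α => ∑ i, c i * Y i α) = ∑ i, c i * metricInner H (u p) X (Y i) := by
    intro X c Y
    simp only [hu.metric.metricInner_comm hup X, innerL]
  -- Skewness gives `⟨R(X, w)X, w⟩ = -⟨R(X, w)w, X⟩ ≥ 0`. By `h1` this trace equals `-|∇w|²`.
  have hcurv : 0 ≤ ∑ i, ∑ j, (G p)⁻¹ i j * metricInner H (u p)
      (curvatureOperator H (u p) (push u i p) (w p) (push u j p)) (w p) := by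
    refine trace_form_nonneg hinv
      (fun X Y => metricInner H (u p) (curvatureOperator H (u p) X (w p) Y) (w p))
      (fun c X Y => ?_) (fun X c Y => ?_) (fun X => ?_) (fun i => push u i p)
    · rw [show curvatureOperator H (u p) (fun α => ∑ i, c i * X i α) (w p) Y = _ from
        funext fun l => curvatureOperator_sum_left _ c X _ _ l, innerL]
    · rw [show curvatureOperator H (u p) X (w p) (fun α => ∑ i, c i * Y i α) = _ from
        funext fun l => curvatureOperator_sum_right _ c Y _ _ l, innerL]
    · rw [hu.metric.inner_curvature_skew hup]
      linarith [hu.metric.inner_curvature_nonpos hup (hsec _ hup) X (w p)]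
  set s := metricInner H (u p) (w p) (η p) with hs
  -- By Weingarten `∇ᵢw + s ∂ᵢu` is the normal part of `∇ᵢw`, so its squared norm is `|∇w|² - 2s²`.
  have hpos := trace_form_nonneg hinv (metricInner H (u p)) innerL innerR
    (hu.metric.metricInner_self_nonneg hup) (fun i α => covAlong H u i w p α + s * push u i p α)
  have hexp : ∀ i j, metricInner H (u p) (fun α => covAlong H u i w p α + s * push u i p α)
      (fun α => covAlong H u j w p α + s * push u j p α) =
      metricInner H (u p) (covAlong H u i w p) (covAlong H u j w p) - s ^ 2 * G p j i := by
    intro i j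
    have e : ∀ a b a' b' : Fin n → ℝ, metricInner H (u p) (fun α => a α + s * b α)
        (fun α => a' α + s * b' α) = metricInner H (u p) a a' + s * metricInner H (u p) a' b +
          s * metricInner H (u p) a b' + s ^ 2 * metricInner H (u p) b b' := by
      intro a b a' b'
      rw [metricInner_add_left, metricInner_smul_left, hu.metric.metricInner_comm hup a,
        hu.metric.metricInner_comm hup b, metricInner_add_left, metricInner_add_left,
        metricInner_smul_left, metricInner_smul_left, hu.metric.metricInner_comm hup a' a,
        hu.metric.metricInner_comm hup b' a, hu.metric.metricInner_comm hup b' b]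
      ring
    rw [e, hu.inner_covAlong_normal hw hn hp, hu.inner_covAlong_normal hw hn hp,
      ← hu.isometric p hp, hu.metricSource.symm hp i j]
    ring
  simp only [hexp, mul_sub, Finset.sum_sub_distrib] at hpos
  have htr : ∑ i, ∑ j, (G p)⁻¹ i j * (s ^ 2 * G p j i) = 2 * s ^ 2 := by
    have : ∀ i j, (G p)⁻¹ i j * (s ^ 2 * G p j i) = (G p)⁻¹ i j * G p j i * s ^ 2 :=
      fun i j => by ring
    simp only [this, ← Finset.sum_mul, hu.sum_inv_mul_self hp, Nat.cast_ofNat]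
  rw [htr] at hpos
  rw [h1] at hcurv
  simp only [mul_neg, Finset.sum_neg_distrib] at hcurv
  have hs0 : s = 0 := by
    have : s ^ 2 ≤ 0 := by linarith
    exact pow_eq_zero_iff two_ne_zero |>.1 (le_antisymm this (sq_nonneg s))
  rw [hs, hwη' p hp, metricInner_smul_left] at hs0
  by_contra hne
  exact (mul_ne_zero (hf p hp) (hu.metric.metricInner_self_pos hup hne).ne') hs0

end JacobiField

/-! ### Conformal changes of the metric on a surface -/

section Conformal

variable {G G' : Coord 2 → Matrix (Fin 2) (Fin 2) ℝ} {H : Coord n → Matrix (Fin n) (Fin n) ℝ}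
  {u : Coord 2 → Coord n} {c : Coord 2 → ℝ} {U : Set (Coord 2)} {p : Coord 2}

lemma conformal_inv (hG : IsMetricOn G U) (hc : ∀ q ∈ U, 0 < c q)
    (h : ∀ q ∈ U, ∀ i j, G' q i j = c q * G q i j) (hp : p ∈ U) (i j : Fin 2) :
    (G' p)⁻¹ i j = (c p)⁻¹ * (G p)⁻¹ i j := by
  have e : G' p = c p • G p := by ext i j; exact h p hp i j
  have : (G' p)⁻¹ = (c p)⁻¹ • (G p)⁻¹ := by
    refine Matrix.inv_eq_left_inv ?_
    rw [e, Matrix.smul_mul, Matrix.mul_smul, smul_smul, inv_mul_cancel₀ (hc p hp).ne', one_smul,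
      Matrix.nonsing_inv_mul _ (isUnit_iff_ne_zero.2 (hG.det_ne_zero hp))]
  rw [this]; rfl

/-- The contracted Christoffel symbols are conformally covariant in dimension two. -/
lemma conformal_trace_christoffel (hG : IsMetricOn G U) (hcs : ContDiffOn ℝ ∞ c U)
    (hc : ∀ q ∈ U, 0 < c q) (h : ∀ q ∈ U, ∀ i j, G' q i j = c q * G q i j) (hp : p ∈ U)
    (k : Fin 2) :
    ∑ i, ∑ j, (G' p)⁻¹ i j * christoffel G' k i j p =
      (c p)⁻¹ * ∑ i, ∑ j, (G p)⁻¹ i j * christoffel G k i j p := by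
  have hc0 := (hc p hp).ne'
  have hpd : ∀ a i j, pd a (fun q => G' q i j) p =
      pd a c p * G p i j + c p * pd a (fun q => G q i j) p := by
    intro a i j
    rw [pd_congr hG.isOpen hp (fun q hq => h q hq i j),
      pd_mul _ (differentiableAt_of_contDiffOn hG.isOpen hcs hp)
        (differentiableAt_of_contDiffOn hG.isOpen (hG.smooth i j) hp)]
  -- The correction has trace proportional to `2 - m` times the gradient of `c`, with `m` the
  -- dimension; `htr` is the case `m = 2`.
  have hchr : ∀ i j, christoffel G' k i j p = christoffel G k i j p + (1 / 2) * (c p)⁻¹ *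
      (pd i c p * (if k = j then 1 else 0) + pd j c p * (if k = i then 1 else 0) -
        G p i j * ∑ l, (G p)⁻¹ k l * pd l c p) := by
    intro i j
    have e : ∀ i j, ∑ l, (G p)⁻¹ k l * (pd i c p * G p j l) =
        pd i c p * (if k = j then 1 else 0) := by
      intro i j
      rw [← hG.inv_mul hp, Finset.mul_sum]
      exact Finset.sum_congr rfl fun l _ => by rw [hG.symm hp j l]; ring
    rw [← e i j, ← e j i]
    unfold christoffel
    simp only [hpd, conformal_inv hG hc h hp, Finset.mul_sum, ← Finset.sum_add_distrib,
      ← Finset.sum_sub_distrib]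
    refine Finset.sum_congr rfl fun l _ => ?_
    field_simp
    ring
  have htr : ∑ i, ∑ j, (G p)⁻¹ i j *
      (pd i c p * (if k = j then 1 else 0) + pd j c p * (if k = i then 1 else 0) -
        G p i j * ∑ l, (G p)⁻¹ k l * pd l c p) = 0 := by
    have t : ∑ i, ∑ j, (G p)⁻¹ i j * G p i j = 2 := by
      have : ∀ i, ∑ j, (G p)⁻¹ i j * G p i j = 1 := by
        intro i
        have := hG.inv_mul hp i i
        rw [if_pos rfl] at this
        rw [← this]
        exact Finset.sum_congr rfl fun j _ => by rw [hG.symm hp]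
      simp [this]
    have e1 : ∑ i, ∑ j, (G p)⁻¹ i j * (pd i c p * (if k = j then 1 else 0)) =
        ∑ l, (G p)⁻¹ k l * pd l c p := by
      simp only [mul_ite, mul_one, mul_zero, Finset.sum_ite_eq, Finset.mem_univ, if_true]
      exact Finset.sum_congr rfl fun i _ => by rw [hG.inv_symm hp]
    have e2 : ∑ i, ∑ j, (G p)⁻¹ i j * (pd j c p * (if k = i then 1 else 0)) =
        ∑ l, (G p)⁻¹ k l * pd l c p := by
      rw [Finset.sum_comm]
      simp
    have e3 : ∑ i, ∑ j, (G p)⁻¹ i j * (G p i j * ∑ l, (G p)⁻¹ k l * pd l c p) =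
        2 * ∑ l, (G p)⁻¹ k l * pd l c p := by
      simp only [← mul_assoc, ← Finset.sum_mul]
      rw [t]
    simp only [mul_sub, mul_add, Finset.sum_sub_distrib, Finset.sum_add_distrib, e1, e2, e3]
    ring
  calc _ = ∑ i, ∑ j, ((c p)⁻¹ * ((G p)⁻¹ i j * christoffel G k i j p) +
        (1 / 2) * (c p)⁻¹ ^ 2 * ((G p)⁻¹ i j *
      (pd i c p * (if k = j then 1 else 0) + pd j c p * (if k = i then 1 else 0) -
        G p i j * ∑ l, (G p)⁻¹ k l * pd l c p))) :=
        Finset.sum_congr rfl fun i _ => Finset.sum_congr rfl fun j _ => by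
          rw [hchr, conformal_inv hG hc h hp]; ring
    _ = _ := by
        simp only [Finset.sum_add_distrib, ← Finset.mul_sum, htr]
        ring

/-- The common shape of the tension field and the rough Laplacian: `T` holds the second derivatives
along the map and `v` the first. -/
lemma conformal_trace (hG : IsMetricOn G U) (hcs : ContDiffOn ℝ ∞ c U)
    (hc : ∀ q ∈ U, 0 < c q) (h : ∀ q ∈ U, ∀ i j, G' q i j = c q * G q i j) (hp : p ∈ U)
    (T : Fin 2 → Fin 2 → ℝ) (v : Fin 2 → ℝ) :
    ∑ i, ∑ j, (G' p)⁻¹ i j * (T i j - ∑ k, christoffel G' k i j p * v k) =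
      (c p)⁻¹ * ∑ i, ∑ j, (G p)⁻¹ i j * (T i j - ∑ k, christoffel G k i j p * v k) := by
  have e : ∀ K : Coord 2 → Matrix (Fin 2) (Fin 2) ℝ,
      ∑ i, ∑ j, (K p)⁻¹ i j * (T i j - ∑ k, christoffel K k i j p * v k) =
      (∑ i, ∑ j, (K p)⁻¹ i j * T i j) -
        ∑ k, (∑ i, ∑ j, (K p)⁻¹ i j * christoffel K k i j p) * v k := by
    intro K
    simp only [mul_sub, Finset.sum_sub_distrib, Finset.mul_sum, Finset.sum_mul, mul_assoc]
    exact congrArg _ Finset.sum_comm_cycle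
  rw [e, e, mul_sub, Finset.mul_sum, Finset.mul_sum]
  congr 1
  · refine Finset.sum_congr rfl fun i _ => ?_
    rw [Finset.mul_sum]
    exact Finset.sum_congr rfl fun j _ => by rw [conformal_inv hG hc h hp, mul_assoc]
  · refine Finset.sum_congr rfl fun k _ => ?_
    rw [conformal_trace_christoffel hG hcs hc h hp, mul_assoc]

lemma conformal_tension (hG : IsMetricOn G U) (hcs : ContDiffOn ℝ ∞ c U)
    (hc : ∀ q ∈ U, 0 < c q) (h : ∀ q ∈ U, ∀ i j, G' q i j = c q * G q i j) (hp : p ∈ U)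
    (α : Fin n) : tension G' H u p α = (c p)⁻¹ * tension G H u p α :=
  conformal_trace hG hcs hc h hp (fun i j => covAlong H u i (push u j) p α)
    fun k => push u k p α

lemma conformal_roughLaplacian (hG : IsMetricOn G U) (hcs : ContDiffOn ℝ ∞ c U)
    (hc : ∀ q ∈ U, 0 < c q) (h : ∀ q ∈ U, ∀ i j, G' q i j = c q * G q i j) (hp : p ∈ U)
    (w : Coord 2 → Fin n → ℝ) (α : Fin n) :
    roughLaplacian G' H u w p α = (c p)⁻¹ * roughLaplacian G H u w p α :=
  conformal_trace hG hcs hc h hp (fun i j => covAlong H u i (covAlong H u j w) p α)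
    fun k => covAlong H u k w p α

end Conformal

/-! ### The theorem on a coordinate patch -/

lemma IsMapOn.tension_smooth {G : Coord m → Matrix (Fin m) (Fin m) ℝ}
    {H : Coord n → Matrix (Fin n) (Fin n) ℝ} {V : Set (Coord n)} {u : Coord m → Coord n}
    {U : Set (Coord m)} (hu : IsMapOn H V u U) (hG : IsMetricOn G U) :
    IsFieldOn (tension G H u) U := fun α =>
  ContDiffOn.sum fun i _ => ContDiffOn.sum fun j _ => (hG.contDiffOn_inv i j).mul <|
    (hu.covAlong_smooth (hu.push_smooth j) i α).sub <| ContDiffOn.sum fun k _ =>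
      (hG.contDiffOn_christoffel k i j).mul (hu.push_smooth k α)

/-- A totally umbilical surface in a nonpositively curved manifold that becomes biharmonic after a
conformal change of its metric is minimal. -/
theorem tension_eq_zero_of_conformal_biharmonic
    {G G' : Coord 2 → Matrix (Fin 2) (Fin 2) ℝ} {H : Coord n → Matrix (Fin n) (Fin n) ℝ}
    {V : Set (Coord n)} {u : Coord 2 → Coord n} {c : Coord 2 → ℝ} {U : Set (Coord 2)}
    (hu : IsMapOn H V u U) (hG : IsMetricOn G U)
    (hiso : ∀ q ∈ U, ∀ j k, G q j k = metricInner H (u q) (push u j q) (push u k q))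
    (humb : ∀ q ∈ U, ∀ i j α, secondForm G H u i j q α = G q i j * ((1 / 2) * tension G H u q α))
    (hcs : ContDiffOn ℝ ∞ c U) (hc : ∀ q ∈ U, 0 < c q)
    (hconf : ∀ q ∈ U, ∀ i j, G' q i j = c q * G q i j)
    (hbi : ∀ q ∈ U, ∀ α, bitension G' H u q α = 0)
    (hsec : ∀ y ∈ V, ∀ X Y : Fin n → ℝ, LinearIndependent ℝ ![X, Y] →
      sectionalCurvature H y X Y ≤ 0) {p : Coord 2} (hp : p ∈ U) (α : Fin n) :
    tension G H u p α = 0 := by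
  have hτ := hu.tension_smooth hG
  have humb' : IsUmbilicOn G H V u (fun q β => (1 / 2) * tension G H u q β) U :=
    { hu with
      metricSource := hG
      isometric := hiso
      normal_smooth := fun β => contDiffOn_const.mul (hτ β)
      umbilic := fun q hq i j β => by
        rw [← humb q hq, secondForm]; ring }
  have hw : ∀ q ∈ U, ∀ β, tension G' H u q β = (c q)⁻¹ * tension G H u q β :=
    fun q hq β => conformal_tension hG hcs hc hconf hq β
  have hws : IsFieldOn (tension G' H u) U := fun β =>
    ((hcs.inv fun q hq => (hc q hq).ne').mul (hτ β)).congr fun q hq => hw q hq β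
  -- The `2` undoes the half in `η = ½ τ`; `(c q)⁻¹` is the conformal scaling of the tension field.
  have h0 := humb'.normal_eq_zero (w := tension G' H u) (f := fun q => 2 * (c q)⁻¹) hws
    (fun q hq => mul_ne_zero two_ne_zero (inv_ne_zero (hc q hq).ne'))
    (fun q hq β => by rw [hw q hq]; ring)
    (fun q hq β => by
      have hb := hbi q hq β
      -- Both terms of the bitension carry the factor `(c q)⁻¹` while `w` stays the rescaled
      -- tension. Dividing it out leaves the Jacobi equation for `G`.
      rw [bitension, conformal_roughLaplacian hG hcs hc hconf hq] at hb
      simp only [conformal_inv hG hc hconf hq, mul_assoc, ← Finset.mul_sum, ← mul_sub] at hb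
      have := (mul_eq_zero.1 hb).resolve_left (inv_ne_zero (hc q hq).ne')
      linarith) hsec hp
  have := congrFun h0 α
  simp only [Pi.zero_apply] at this
  linarith

end LocalGeom

/-! ### Metrics and maps in charts -/

section Charts

variable {m n : ℕ}
  {M : Type*} [TopologicalSpace M] [ChartedSpace (Coord m) M]
  {N : Type*} [TopologicalSpace N] [ChartedSpace (Coord n) N]
  {e : OpenPartialHomeomorph M (Coord m)} {e' : OpenPartialHomeomorph N (Coord n)}
  {φ : M → N} {p : Coord m}

lemma IsSmoothChart.mdifferentiableAt_symm (he : IsSmoothChart m e) (hp : p ∈ e.target) :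
    MDifferentiableAt (𝓡 m) (𝓡 m) e.symm p :=
  (contMDiffAt_symm_of_mem_maximalAtlas he hp).mdifferentiableAt (by simp)

lemma contMDiff_coordSection (i : Fin m) : ContMDiff (𝓡 m) (𝓡 m).tangent ∞
    (fun p : Coord m => (⟨p, EuclideanSpace.single i (1 : ℝ)⟩ : TangentBundle (𝓡 m) (Coord m))) := by
  intro p
  rw [Bundle.contMDiffAt_totalSpace]
  refine ⟨contMDiffAt_id, ?_⟩
  simpa using contMDiffAt_const

lemma IsSmoothChart.contMDiffOn_coordVector [IsManifold (𝓡 m) ∞ M] (he : IsSmoothChart m e)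
    (i : Fin m) : ContMDiffOn (𝓡 m) (𝓡 m).tangent ∞
      (fun p => (⟨e.symm p, coordVector e i p⟩ : TangentBundle (𝓡 m) M)) e.target := by
  have h1 := (contMDiffOn_symm_of_mem_maximalAtlas he).contMDiffOn_tangentMapWithin
    (m := ∞) (by simp) e.open_target.uniqueMDiffOn
  have h2 := h1.comp (contMDiff_coordSection i).contMDiffOn (s := e.target)
    (fun p hp => hp)
  refine h2.congr fun p hp => ?_
  simp only [Function.comp, tangentMapWithin, coordVector]
  rw [mfderivWithin_of_isOpen e.open_target hp]

lemma mfderiv_symm_eq_sum (e : OpenPartialHomeomorph M (Coord m)) (p v : Coord m) :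
    mfderiv (𝓡 m) (𝓡 m) e.symm p v = ∑ i, v i • coordVector e i p := by
  have : v = ∑ c, v c • EuclideanSpace.single c (1 : ℝ) := by
    ext a; simp [Finset.sum_apply, Pi.single_apply]
  conv_lhs => rw [this]
  simp only [coordVector]
  erw [map_sum]
  refine Finset.sum_congr rfl fun i _ => ?_
  erw [map_smul]

lemma metric_mfderiv_symm [IsManifold (𝓡 m) ∞ M] (g : SmoothMetric m M)
    (e : OpenPartialHomeomorph M (Coord m)) (p v w : Coord m) :
    g.inner (e.symm p) (mfderiv (𝓡 m) (𝓡 m) e.symm p v) (mfderiv (𝓡 m) (𝓡 m) e.symm p w) =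
      LocalGeom.metricInner (metricInChart g e) p v w := by
  rw [mfderiv_symm_eq_sum, mfderiv_symm_eq_sum]
  simp only [map_sum, map_smul, sum_apply, smul_apply,
    smul_eq_mul, LocalGeom.metricInner, metricInChart, Matrix.of_apply, Finset.mul_sum]
  rw [Finset.sum_comm]
  exact Finset.sum_congr rfl fun i _ => Finset.sum_congr rfl fun j _ => by ring

/-- Differentiate `e ∘ e.symm = id` near `p`. This is what makes the coefficient matrix of a metric
positive definite. -/
lemma IsSmoothChart.mfderiv_symm_injective [IsManifold (𝓡 m) ∞ M] (he : IsSmoothChart m e)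
    (hp : p ∈ e.target) {v : Coord m} (hv : v ≠ 0) : mfderiv (𝓡 m) (𝓡 m) e.symm p v ≠ 0 := by
  intro h0
  have hd : MDifferentiableAt (𝓡 m) (𝓡 m) e (e.symm p) :=
    (contMDiffAt_of_mem_maximalAtlas he (e.map_target hp)).mdifferentiableAt (by simp)
  have h1 := mfderiv_comp p hd (he.mdifferentiableAt_symm hp)
  have h2 : (e ∘ e.symm) =ᶠ[nhds p] id :=
    Filter.eventually_of_mem (e.open_target.mem_nhds hp) fun q hq => e.right_inv hq
  rw [h2.mfderiv_eq, mfderiv_id] at h1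
  apply hv
  have h3 := congrArg (fun L : TangentSpace (𝓡 m) p →L[ℝ] TangentSpace (𝓡 m) p => L v) h1
  change v = mfderiv (𝓡 m) (𝓡 m) e (e.symm p) (mfderiv (𝓡 m) (𝓡 m) e.symm p v) at h3
  rw [h3, h0, map_zero]
  rfl

lemma IsSmoothChart.isMetricOn [IsManifold (𝓡 m) ∞ M] (g : SmoothMetric m M)
    (he : IsSmoothChart m e) : LocalGeom.IsMetricOn (metricInChart g e) e.target where
  isOpen := e.open_target
  smooth i j := by
    have hg : ContMDiffOn (𝓡 m) ((𝓡 m).prod 𝓘(ℝ, Coord m →L[ℝ] Coord m →L[ℝ] ℝ)) ∞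
        (fun p => Bundle.TotalSpace.mk' (Coord m →L[ℝ] Coord m →L[ℝ] ℝ)
          (E := fun x : M => TangentSpace (𝓡 m) x →L[ℝ] TangentSpace (𝓡 m) x →L[ℝ] ℝ)
          (e.symm p) (g.inner (e.symm p))) e.target :=
      g.contMDiff.comp_contMDiffOn (contMDiffOn_symm_of_mem_maximalAtlas he)
    intro p hp
    have : ContMDiffWithinAt (𝓡 m) ((𝓡 m).prod 𝓘(ℝ)) ∞
        (fun p => Bundle.TotalSpace.mk' ℝ (E := Bundle.Trivial M ℝ) (e.symm p)
          (g.inner (e.symm p) (coordVector e i p) (coordVector e j p))) e.target p :=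
      ContMDiffWithinAt.clm_bundle_apply₂ (F₁ := Coord m) (F₂ := Coord m) (hg p hp)
        (he.contMDiffOn_coordVector i p hp) (he.contMDiffOn_coordVector j p hp)
    rw [Bundle.contMDiffWithinAt_totalSpace] at this
    exact this.2.contDiffWithinAt
  posDef p hp := by
    refine Matrix.PosDef.of_dotProduct_mulVec_pos ?_ fun x hx => ?_
    · ext i j
      simp [metricInChart, g.symm]
    · have hx' : (WithLp.toLp 2 x : Coord m) ≠ 0 := by simpa using hx
      have h1 := g.pos _ _ (he.mfderiv_symm_injective hp hx')
      rw [metric_mfderiv_symm] at h1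
      have h : star x ⬝ᵥ (metricInChart g e p).mulVec x =
          LocalGeom.metricInner (metricInChart g e) p x x := by
        simp only [LocalGeom.metricInner, dotProduct, Matrix.mulVec, Finset.mul_sum, star_trivial]
        exact Finset.sum_congr rfl fun i _ => Finset.sum_congr rfl fun j _ => by ring
      rwa [h]

/-- The domain of the coordinate expression of a map. -/
def chartDomain (φ : M → N) (e : OpenPartialHomeomorph M (Coord m))
    (e' : OpenPartialHomeomorph N (Coord n)) : Set (Coord m) :=
  e.target ∩ (fun p => φ (e.symm p)) ⁻¹' e'.source

lemma IsSmoothChart.isMapOn [IsManifold (𝓡 n) ∞ N] (h : SmoothMetric n N)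
    (he : IsSmoothChart m e) (he' : IsSmoothChart n e') (hφ : ContMDiff (𝓡 m) (𝓡 n) ∞ φ) :
    LocalGeom.IsMapOn (metricInChart h e') e'.target (mapInCharts φ e e')
      (chartDomain φ e e') where
  metric := he'.isMetricOn h
  isOpen := (hφ.continuous.comp_continuousOn e.symm.continuousOn).isOpen_inter_preimage
    e.open_target e'.open_source
  smooth α := by
    have h1 : ContMDiffOn (𝓡 m) (𝓡 n) ∞ (mapInCharts φ e e') (chartDomain φ e e') :=
      (contMDiffOn_of_mem_maximalAtlas he').comp
        (hφ.comp_contMDiffOn ((contMDiffOn_symm_of_mem_maximalAtlas he).mono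
          Set.inter_subset_left)) fun p hp => hp.2
    exact contDiffOn_euclidean.1 h1.contDiffOn α
  mapsTo p hp := e'.map_source hp.2

lemma IsIsometricImmersion.metricInChart_eq [IsManifold (𝓡 m) ∞ M] [IsManifold (𝓡 n) ∞ N]
    {g : SmoothMetric m M} {h : SmoothMetric n N}
    (hiso : IsIsometricImmersion g h φ) (he : IsSmoothChart m e) (he' : IsSmoothChart n e')
    (hp : p ∈ chartDomain φ e e') (j k : Fin m) :
    metricInChart g e p j k = LocalGeom.metricInner (metricInChart h e') (mapInCharts φ e e' p)
      (LocalGeom.push (mapInCharts φ e e') j p) (LocalGeom.push (mapInCharts φ e e') k p) := by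
  set u := mapInCharts φ e e' with hu_def
  have hu := he.isMapOn h he' hiso.1
  have hup := hu.mapsTo hp
  have hud : DifferentiableAt ℝ u p := differentiableAt_euclidean.2 (hu.differentiableAt hp)
  have hsu : e'.symm (u p) = φ (e.symm p) := e'.left_inv hp.2
  have hpush : ∀ i, (WithLp.toLp 2 (LocalGeom.push u i p) : Coord n) =
      fderiv ℝ u p (EuclideanSpace.single i 1) := by
    intro i
    ext c
    have h2 : HasFDerivAt (fun q => u q c) ((EuclideanSpace.proj c).comp (fderiv ℝ u p)) p :=
      (EuclideanSpace.proj c : Coord n →L[ℝ] ℝ).hasFDerivAt.comp p hud.hasFDerivAt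
    simp [LocalGeom.push, LocalGeom.pd, h2.fderiv]
  -- Differentiating both factorisations by the chain rule identifies `dφ(∂ᵢ)` with the vector whose
  -- `e'`-coordinates are `push u i p`.
  have hev : (φ ∘ e.symm) =ᶠ[nhds p] (e'.symm ∘ u) :=
    Filter.eventually_of_mem (hu.isOpen.mem_nhds hp) fun q hq => (e'.left_inv hq.2).symm
  have hφd : MDifferentiableAt (𝓡 m) (𝓡 n) φ (e.symm p) := hiso.1.mdifferentiableAt (by simp)
  have hL := mfderiv_comp p hφd (he.mdifferentiableAt_symm hp.1)
  have hR := mfderiv_comp p (he'.mdifferentiableAt_symm hup) hud.mdifferentiableAt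
  rw [hev.mfderiv_eq, hR] at hL
  have hvec : ∀ i, mfderiv (𝓡 m) (𝓡 n) φ (e.symm p) (coordVector e i p) =
      mfderiv (𝓡 n) (𝓡 n) e'.symm (u p) (WithLp.toLp 2 (LocalGeom.push u i p) : Coord n) := by
    intro i
    rw [hpush i, ← mfderiv_eq_fderiv]
    exact (congrArg (fun L : Coord m →L[ℝ] Coord n => L (EuclideanSpace.single i 1)) hL).symm
  have key := metric_mfderiv_symm h e' (u p) (WithLp.toLp 2 (LocalGeom.push u j p))
    (WithLp.toLp 2 (LocalGeom.push u k p))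
  rw [← hvec, ← hvec] at key
  rw [metricInChart, Matrix.of_apply, ← hiso.2]
  rw [hsu] at key
  exact key

end Charts

/-! ### From charts to the manifold -/

/-- The conformal factor of a conformal rescaling is smooth in charts, and the metrics are
proportional. -/
lemma IsConformalRescaling.exists_factor {m : ℕ} {M : Type*} [TopologicalSpace M]
    [ChartedSpace (Coord m) M] [IsManifold (𝓡 m) ∞ M] {g gbar : SmoothMetric m M} {lam : M → ℝ}
    (hconf : IsConformalRescaling g gbar lam) {e : OpenPartialHomeomorph M (Coord m)}
    (he : IsSmoothChart m e) (i₀ : Fin m) :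
    ∃ c : Coord m → ℝ, ContDiffOn ℝ ∞ c e.target ∧ (∀ q ∈ e.target, 0 < c q) ∧
      ∀ q ∈ e.target, ∀ i j, metricInChart gbar e q i j = c q * metricInChart g e q i j := by
  have hG := he.isMetricOn g
  have hscale : ∀ q i j, metricInChart gbar e q i j =
      (lam (e.symm q) ^ 2)⁻¹ * metricInChart g e q i j := fun q i j => hconf.2 _ _ _
  refine ⟨fun q => (lam (e.symm q) ^ 2)⁻¹, ?_, fun q _ => inv_pos.2 (pow_pos (hconf.1 _) 2),
    fun q _ => hscale q⟩
  -- Smoothness of `lam` is not assumed; it comes from writing `λ⁻²` as a quotient of diagonal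
  -- metric coefficients, which is why an index `i₀` is required.
  refine (((he.isMetricOn gbar).smooth i₀ i₀).div (hG.smooth i₀ i₀) fun q hq =>
    (hG.diag_pos hq i₀).ne').congr fun q hq => ?_
  change _ = metricInChart gbar e q i₀ i₀ / metricInChart g e q i₀ i₀
  rw [hscale, mul_div_assoc, div_self (hG.diag_pos hq i₀).ne', mul_one]

theorem mainTheorem8
    {M : Type*} [TopologicalSpace M] [ChartedSpace (Coord 2) M] [IsManifold (𝓡 2) ∞ M]
    {N : Type*} [TopologicalSpace N] [ChartedSpace (Coord 3) N] [IsManifold (𝓡 3) ∞ N]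
    (g : SmoothMetric 2 M) (h : SmoothMetric 3 N) (φ : M → N)
    (hN : NonpositivelyCurved h)
    (hiso : IsIsometricImmersion g h φ)
    (humb : IsTotallyUmbilical g h φ)
    (gbar : SmoothMetric 2 M) (lam : M → ℝ)
    (hconf : IsConformalRescaling g gbar lam)
    (hbi : IsBiharmonicMap gbar h φ) :
    IsHarmonicMap gbar h φ ∧ IsTotallyGeodesic g h φ := by

  have key : ∀ (e : OpenPartialHomeomorph M (Coord 2)) (e' : OpenPartialHomeomorph N (Coord 3)),
      IsSmoothChart 2 e → IsSmoothChart 3 e' → ∀ p ∈ chartDomain φ e e', ∀ α,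
        LocalGeom.tension (metricInChart g e) (metricInChart h e') (mapInCharts φ e e') p α = 0 ∧
        LocalGeom.tension (metricInChart gbar e) (metricInChart h e') (mapInCharts φ e e') p α
          = 0 := by
    intro e e' he he' p hp α
    obtain ⟨c, hcs, hc, hcG⟩ := hconf.exists_factor he 0
    have hu := he.isMapOn h he' hiso.1
    have hG : LocalGeom.IsMetricOn (metricInChart g e) (chartDomain φ e e') :=
      { isOpen := hu.isOpen
        smooth := fun i j => ((he.isMetricOn g).smooth i j).mono Set.inter_subset_left
        posDef := fun q hq => (he.isMetricOn g).posDef q hq.1 }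
    have hcs' := hcs.mono (Set.inter_subset_left : chartDomain φ e e' ⊆ e.target)
    have hτ := LocalGeom.tension_eq_zero_of_conformal_biharmonic hu hG
      (fun q hq => hiso.metricInChart_eq he he' hq)
      (fun q hq i j β => by simpa using humb e e' he he' q hq.1 hq.2 i j β)
      hcs' (fun q hq => hc q hq.1) (fun q hq => hcG q hq.1)
      (fun q hq => hbi e e' he he' q hq.1 hq.2) (fun y hy => hN e' he' y hy) hp α
    refine ⟨hτ, ?_⟩
    rw [LocalGeom.conformal_tension hG hcs' (fun q hq => hc q hq.1) (fun q hq => hcG q hq.1) hp,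
      hτ, mul_zero]
  refine ⟨fun e e' he he' p hp hp' α => (key e e' he he' p ⟨hp, hp'⟩ α).2,
    fun e e' he he' p hp hp' i j α => ?_⟩
  -- For an umbilical immersion `B = g ⊗ ½τ_g`, so minimal already means totally geodesic.
  rw [humb e e' he he' p hp hp', (key e e' he he' p ⟨hp, hp'⟩ α).1, mul_zero, mul_zero]
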